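/- Let $G$ be a nonempty, second-countable, locally compact, Hausdorff, étale groupoid (that is, a groupoid with a topology for which the range map $r$, the source map $s$ and composition are continuous, and $r,s : G \to G^{(0)}$ are local homeomorphisms onto the unit space $G^{(0)} = \{\gamma\gamma^{-1} : \gamma \in G\}$ with its subspace topology). Let $C_c(G)$ be the complex $*$-algebra of compactly supported continuous functions $G \to \mathbb{C}$ with $$(f * g)(\gamma) = \sum_{r(\alpha) = r(\gamma)} f(\alpha)\, g(\alpha^{-1}\gamma), \qquad f^*(\gamma) = \overline{f(\gamma^{-1})},$$ and let $\|f\|_I = \sup_{u \in G^{(0)}} \max\bigl\{\sum_{s(\gamma) = u} |f(\gamma)|, \sum_{r(\gamma) = u} |f(\gamma)|\bigr\}$. The full C*-algebra $C^*(G)$ is the completion of $C_c(G)$ in the norm $\|f\| = \sup \|\pi(f)\|$, the supremum being taken over all $\|\cdot\|_I$-bounded $*$-representations $\pi$ of $C_c(G)$ on Hilbert spaces. The reduced C*-algebra $C^*_r(G)$ is the completion of $C_c(G)$ in the norm $\|f\|_r = \sup_{u \in G^{(0)}} \|\mathrm{Ind}_u(f)\|$, where $\mathrm{Ind}_u$ is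 the representation of $C_c(G)$ by convolution on $\ell^2(G_u)$, $G_u = \{\gamma \in G : s(\gamma) = u\}$, i.e. $(\mathrm{Ind}_u(f)x)(\gamma) = \sum_{\beta \in G_u} f(\gamma\beta^{-1})x(\beta)$. Then $C^*(G)$ is simple (nonzero, with no closed two-sided ideals other than $0$ and itself) if and only if all of the following conditions are satisfied: 1. $C^*(G) = C^*_r(G)$, i.e. the identity map of $C_c(G)$ extends to an isomorphism $C^*(G) \to C^*_r(G)$; 2. $G$ is topologically principal, i.e. the set of units $u$ with $\{\gamma \in G : r(\gamma) = s(\gamma) = u\} = \{u\}$ is dense in $G^{(0)}$; and 3. $G$ is minimal, i.e. the only open subsets $U \subseteq G^{(0)}$ such that $s(\gamma) \in U \implies r(\gamma) \in U$ for all $\gamma \in G$ are $\emptyset$ and $G^{(0)}$. -/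

import Mathlib

/-! ## C*-seminorms and their completions -/

/-- A C*-seminorm on a complex `*`-algebra `A`: a submultiplicative seminorm with
`p (a* a) = p a ^ 2`. -/
structure CStarSeminorm (A : Type*) [NonUnitalRing A] [StarRing A] [Module ℂ A] extends
    Seminorm ℂ A where
  mul_le' : ∀ a b, toFun (a * b) ≤ toFun a * toFun b
  star_mul_self' : ∀ a, toFun (star a * a) = toFun a * toFun a

namespace CStarSeminorm

variable {A : Type*} [NonUnitalRing A] [StarRing A] [Module ℂ A]

lemma star_le (p : CStarSeminorm A) (a : A) : p.toSeminorm (star a) ≤ p.toSeminorm a := by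
  have h1 : p.toSeminorm (star (star a) * star a) = p.toSeminorm (star a) * p.toSeminorm (star a) :=
    p.star_mul_self' (star a)
  have h2 : p.toSeminorm (star (star a) * star a)
      ≤ p.toSeminorm (star (star a)) * p.toSeminorm (star a) := p.mul_le' _ _
  rw [star_star] at h1 h2
  have h0 := apply_nonneg p.toSeminorm (star a)
  have h0' := apply_nonneg p.toSeminorm a
  by_contra! hlt
  nlinarith

lemma star_eq (p : CStarSeminorm A) (a : A) : p.toSeminorm (star a) = p.toSeminorm a :=
  le_antisymm (p.star_le a) (by simpa using p.star_le (star a))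

/-- The algebra `A` with the topology given by the seminorm `p`. -/
def Carrier (_p : CStarSeminorm A) : Type _ := A

instance (p : CStarSeminorm A) : NonUnitalRing p.Carrier := inferInstanceAs (NonUnitalRing A)
instance (p : CStarSeminorm A) : StarRing p.Carrier := inferInstanceAs (StarRing A)
instance (p : CStarSeminorm A) : Module ℂ p.Carrier := inferInstanceAs (Module ℂ A)
instance (p : CStarSeminorm A) [IsScalarTower ℂ A A] : IsScalarTower ℂ p.Carrier p.Carrier :=
  inferInstanceAs (IsScalarTower ℂ A A)
instance (p : CStarSeminorm A) [SMulCommClass ℂ A A] : SMulCommClass ℂ p.Carrier p.Carrier :=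
  inferInstanceAs (SMulCommClass ℂ A A)
instance (p : CStarSeminorm A) [StarModule ℂ A] : StarModule ℂ p.Carrier :=
  inferInstanceAs (StarModule ℂ A)

noncomputable instance (p : CStarSeminorm A) : NonUnitalSeminormedRing p.Carrier :=
  { (AddGroupSeminorm.toSeminormedAddCommGroup (E := p.Carrier) p.toSeminorm.toAddGroupSeminorm),
    (inferInstance : NonUnitalRing p.Carrier) with
    norm_mul_le := p.mul_le' }

noncomputable instance (p : CStarSeminorm A) : NormedSpace ℂ p.Carrier where
  norm_smul_le c a := (map_smul_eq_mul p.toSeminorm c (a : A)).le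

lemma norm_carrier (p : CStarSeminorm A) (a : p.Carrier) : ‖a‖ = p.toSeminorm (a : A) := rfl

instance (p : CStarSeminorm A) : NormedStarGroup p.Carrier where
  norm_star_le a := p.star_le a

/-- The Hausdorff completion of the `*`-algebra `A` in the C*-seminorm `p`. -/
def Compl (p : CStarSeminorm A) : Type _ := UniformSpace.Completion p.Carrier

section Compl

open UniformSpace UniformSpace.Completion

variable (p : CStarSeminorm A)

noncomputable instance : NormedAddCommGroup p.Compl :=
  inferInstanceAs (NormedAddCommGroup (Completion p.Carrier))
noncomputable instance : NormedSpace ℂ p.Compl :=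
  inferInstanceAs (NormedSpace ℂ (Completion p.Carrier))
instance : CompleteSpace p.Compl := inferInstanceAs (CompleteSpace (Completion p.Carrier))

/-- The canonical map of `A` into its completion. -/
noncomputable def toCompl (a : A) : p.Compl := ((show p.Carrier from a : p.Carrier) : Completion p.Carrier)

lemma denseRange_toCompl : DenseRange p.toCompl :=
  Completion.denseRange_coe (α := p.Carrier)
lemma norm_toCompl (a : A) : ‖p.toCompl a‖ = p.toSeminorm a :=
  Completion.norm_coe (E := p.Carrier) a
lemma toCompl_add (a b : A) : p.toCompl (a + b) = p.toCompl a + p.toCompl b :=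
  Completion.coe_add (α := p.Carrier) a b
lemma toCompl_zero : p.toCompl 0 = 0 := rfl
lemma toCompl_smul (c : ℂ) (a : A) : p.toCompl (c • a) = c • p.toCompl a :=
  Completion.coe_smul (X := p.Carrier) c a

/-- Multiplication on the completion: the continuous extension of the multiplication of `A`. -/
noncomputable instance : Mul p.Compl :=
  ⟨fun x y => (Completion.isDenseInducing_coe (α := p.Carrier)).prodMap
    (Completion.isDenseInducing_coe (α := p.Carrier)) |>.extend
      (fun z : p.Carrier × p.Carrier => p.toCompl ((z.1 * z.2 : p.Carrier) : A)) (x, y)⟩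

/-- Involution on the completion: the continuous extension of the involution of `A`. -/
noncomputable instance : Star p.Compl :=
  ⟨fun x => Completion.map (fun a : p.Carrier => star a) x⟩

lemma toCompl_mul (a b : A) : p.toCompl (a * b) = p.toCompl a * p.toCompl b :=
  (((Completion.isDenseInducing_coe (α := p.Carrier)).prodMap
    (Completion.isDenseInducing_coe (α := p.Carrier))).extend_eq
      ((Completion.continuous_coe p.Carrier).comp continuous_mul)
      ((a, b) : p.Carrier × p.Carrier)).symm

lemma toCompl_star (a : A) : p.toCompl (star a) = star (p.toCompl a) :=
  (Completion.map_coe (f := fun a : p.Carrier => star a)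
    (star_isometry (E := p.Carrier)).uniformContinuous a).symm

lemma continuous_mul_compl : Continuous fun z : p.Compl × p.Compl => z.1 * z.2 := by
  let m := (AddMonoidHom.mul : p.Carrier →+ p.Carrier →+ p.Carrier).compr₂
    (Completion.toCompl : p.Carrier →+ Completion p.Carrier)
  have hm : Continuous fun z : p.Carrier × p.Carrier => m z.1 z.2 :=
    (Completion.continuous_coe p.Carrier).comp continuous_mul
  have di : IsDenseInducing (Completion.toCompl : p.Carrier → Completion p.Carrier) :=
    Completion.isDenseInducing_coe
  exact (di.extend_Z_bilin di hm :)

lemma continuous_star_compl : Continuous fun z : p.Compl => star z :=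
  Completion.continuous_map (f := fun a : p.Carrier => star a)

instance : ContinuousMul p.Compl := ⟨continuous_mul_compl p⟩

instance : ContinuousStar p.Compl := ⟨continuous_star_compl p⟩

lemma ind₁ {P : p.Compl → Prop} (hc : IsClosed {x | P x}) (h : ∀ a, P (p.toCompl a)) (x) : P x :=
  Completion.induction_on (α := p.Carrier) x hc h

lemma ind₂ {P : p.Compl → p.Compl → Prop} (hc : IsClosed {x : p.Compl × p.Compl | P x.1 x.2})
    (h : ∀ a b, P (p.toCompl a) (p.toCompl b)) (x y) : P x y :=
  Completion.induction_on₂ (α := p.Carrier) x y hc h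

lemma ind₃ {P : p.Compl → p.Compl → p.Compl → Prop}
    (hc : IsClosed {x : p.Compl × p.Compl × p.Compl | P x.1 x.2.1 x.2.2})
    (h : ∀ a b c, P (p.toCompl a) (p.toCompl b) (p.toCompl c)) (x y z) : P x y z :=
  Completion.induction_on₃ (α := p.Carrier) x y z hc h

noncomputable instance : NonUnitalNormedRing p.Compl where
  left_distrib := ind₃ p (isClosed_eq (by fun_prop) (by fun_prop)) fun a b c => by
    simp only [← toCompl_mul, ← toCompl_add, mul_add]
  right_distrib := ind₃ p (isClosed_eq (by fun_prop) (by fun_prop)) fun a b c => by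
    simp only [← toCompl_mul, ← toCompl_add, add_mul]
  zero_mul := ind₁ p (isClosed_eq (by fun_prop) (by fun_prop)) fun a => by
    rw [← toCompl_zero, ← toCompl_mul, zero_mul]
  mul_zero := ind₁ p (isClosed_eq (by fun_prop) (by fun_prop)) fun a => by
    rw [← toCompl_zero, ← toCompl_mul, mul_zero]
  mul_assoc := ind₃ p (isClosed_eq (by fun_prop) (by fun_prop)) fun a b c => by
    simp only [← toCompl_mul, mul_assoc]
  dist_eq := dist_eq_norm_neg_add
  norm_mul_le := ind₂ p (isClosed_le (by fun_prop) (by fun_prop)) fun a b => by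
    rw [← toCompl_mul, norm_toCompl, norm_toCompl, norm_toCompl]; exact p.mul_le' a b

noncomputable instance : StarRing p.Compl where
  star_involutive := ind₁ p (isClosed_eq (by fun_prop) (by fun_prop)) fun a => by
    simp only [← toCompl_star, star_star]
  star_mul := ind₂ p (isClosed_eq (by fun_prop) (by fun_prop)) fun a b => by
    simp only [← toCompl_star, ← toCompl_mul, star_mul]
  star_add := ind₂ p (isClosed_eq (by fun_prop) (by fun_prop)) fun a b => by
    simp only [← toCompl_star, ← toCompl_add, star_add]

lemma compl_smul_mul [IsScalarTower ℂ A A] (c : ℂ) :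
    ∀ x y : p.Compl, (c • x) * y = c • (x * y) :=
  ind₂ p (isClosed_eq ((continuous_fst.const_smul c).mul continuous_snd)
    ((continuous_fst.mul continuous_snd).const_smul c)) fun a b => by
    rw [← toCompl_smul, ← toCompl_mul, ← toCompl_mul, ← toCompl_smul, smul_mul_assoc]

lemma compl_mul_smul [SMulCommClass ℂ A A] (c : ℂ) :
    ∀ x y : p.Compl, x * (c • y) = c • (x * y) :=
  ind₂ p (isClosed_eq (continuous_fst.mul (continuous_snd.const_smul c))
    ((continuous_fst.mul continuous_snd).const_smul c)) fun a b => by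
    rw [← toCompl_smul, ← toCompl_mul, ← toCompl_mul, ← toCompl_smul, mul_smul_comm]

lemma compl_norm_mul_self_le : ∀ x : p.Compl, ‖x‖ * ‖x‖ ≤ ‖star x * x‖ :=
  ind₁ p (isClosed_le (continuous_norm.mul continuous_norm)
    (continuous_norm.comp (continuous_star.mul continuous_id))) fun a => by
    rw [← toCompl_star, ← toCompl_mul, norm_toCompl, norm_toCompl]
    exact (p.star_mul_self' a).ge

lemma compl_star_smul [StarModule ℂ A] (c : ℂ) :
    ∀ x : p.Compl, star (c • x) = star c • star x :=
  ind₁ p (isClosed_eq ((continuous_id.const_smul c).star) (continuous_star.const_smul (star c)))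
    fun a => by
      rw [← toCompl_smul, ← toCompl_star, ← toCompl_star, ← toCompl_smul, star_smul]

/-- The completion of a complex `*`-algebra in a C*-seminorm is a C*-algebra. -/
noncomputable instance [IsScalarTower ℂ A A] [SMulCommClass ℂ A A] [StarModule ℂ A] :
    NonUnitalCStarAlgebra p.Compl where
  norm_smul_le := norm_smul_le
  norm_mul_self_le := compl_norm_mul_self_le p
  smul_assoc := compl_smul_mul p
  smul_comm c x y := (compl_mul_smul p c x y).symm
  star_smul := compl_star_smul p

end Compl

/-- The supremum of the operator norms over a pointwise bounded family of `*`-representations. -/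
noncomputable def ofFamily {ι : Type*} {H : ι → Type*} [∀ i, NormedAddCommGroup (H i)]
    [∀ i, InnerProductSpace ℂ (H i)] [∀ i, CompleteSpace (H i)]
    (π : ∀ i, A →⋆ₙₐ[ℂ] (H i →L[ℂ] H i)) (hb : ∀ a, BddAbove (Set.range fun i => ‖π i a‖)) :
    CStarSeminorm A where
  toFun a := ⨆ i, ‖π i a‖
  map_zero' := by simp
  add_le' a b := by
    refine Real.iSup_le (fun i => ?_) (add_nonneg (Real.iSup_nonneg fun _ => norm_nonneg _)
      (Real.iSup_nonneg fun _ => norm_nonneg _))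
    rw [map_add]
    exact (norm_add_le _ _).trans (add_le_add (le_ciSup (hb a) i) (le_ciSup (hb b) i))
  neg' a := by simp
  smul' c a := by
    simp only [map_smul, norm_smul]
    exact (Real.mul_iSup_of_nonneg (norm_nonneg _) _).symm
  mul_le' a b := by
    refine Real.iSup_le (fun i => ?_) (mul_nonneg (Real.iSup_nonneg fun _ => norm_nonneg _)
      (Real.iSup_nonneg fun _ => norm_nonneg _))
    rw [map_mul]
    exact (norm_mul_le _ _).trans (mul_le_mul (le_ciSup (hb a) i) (le_ciSup (hb b) i)
      (norm_nonneg _) (Real.iSup_nonneg fun _ => norm_nonneg _))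
  star_mul_self' a := by
    have h0 : 0 ≤ ⨆ i, ‖π i a‖ := Real.iSup_nonneg fun _ => norm_nonneg _
    apply le_antisymm
    · refine Real.iSup_le (fun i => ?_) (mul_nonneg h0 h0)
      rw [map_mul, map_star, CStarRing.norm_star_mul_self]
      exact mul_le_mul (le_ciSup (hb a) i) (le_ciSup (hb a) i) (norm_nonneg _) h0
    · have h1 : ∀ i, ‖π i a‖ ≤ √(⨆ i, ‖π i (star a * a)‖) := fun i => by
        apply Real.le_sqrt_of_sq_le
        have : ‖π i (star a * a)‖ = ‖π i a‖ ^ 2 := by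
          rw [map_mul, map_star, CStarRing.norm_star_mul_self, sq]
        rw [← this]
        exact le_ciSup (hb (star a * a)) i
      have h2 : ⨆ i, ‖π i a‖ ≤ √(⨆ i, ‖π i (star a * a)‖) := Real.iSup_le h1 (Real.sqrt_nonneg _)
      calc (⨆ i, ‖π i a‖) * (⨆ i, ‖π i a‖) ≤ √(⨆ i, ‖π i (star a * a)‖) *
          √(⨆ i, ‖π i (star a * a)‖) := mul_le_mul h2 h2 h0 (Real.sqrt_nonneg _)
        _ = _ := Real.mul_self_sqrt (Real.iSup_nonneg fun _ => norm_nonneg _)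

end CStarSeminorm

/-- A C*-algebra is simple if it is nonzero and has no closed two-sided ideals except `0` and
itself. -/
def IsSimpleCStarAlgebra (A : Type*) [NonUnitalCStarAlgebra A] : Prop :=
  Nontrivial A ∧ ∀ I : Submodule ℂ A, IsClosed (I : Set A) →
    (∀ a : A, ∀ x ∈ I, a * x ∈ I ∧ x * a ∈ I) → I = ⊥ ∨ I = ⊤

/-! ## Groupoids -/

/-- A groupoid, presented by its set of arrows: units are identified with identity arrows, and
`src`, `rng` send an arrow to its source and range. The product `a * b` is only meaningful when
`src a = rng b`; the values of `*` on other pairs are irrelevant. -/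
class ArrowGroupoid (G : Type*) extends Mul G, Inv G where
  src : G → G
  rng : G → G
  src_src : ∀ a, src (src a) = src a
  rng_src : ∀ a, rng (src a) = src a
  src_rng : ∀ a, src (rng a) = rng a
  rng_rng : ∀ a, rng (rng a) = rng a
  src_mul : ∀ a b, src a = rng b → src (a * b) = src b
  rng_mul : ∀ a b, src a = rng b → rng (a * b) = rng a
  mul_assoc : ∀ a b c, src a = rng b → src b = rng c → a * b * c = a * (b * c)
  rng_mul_self : ∀ a, rng a * a = a
  self_mul_src : ∀ a, a * src a = a
  src_inv : ∀ a, src a⁻¹ = rng a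
  rng_inv : ∀ a, rng a⁻¹ = src a
  mul_inv : ∀ a, a * a⁻¹ = rng a
  inv_mul : ∀ a, a⁻¹ * a = src a

namespace ArrowGroupoid

variable {G : Type*} [ArrowGroupoid G]

variable (G) in
/-- The unit space, the set of all `γ γ⁻¹`. -/
def unitSpace : Set G := Set.range fun γ : G => γ * γ⁻¹

lemma rng_mem (γ : G) : rng γ ∈ unitSpace G := ⟨γ, mul_inv γ⟩

lemma src_mem (γ : G) : src γ ∈ unitSpace G := ⟨src γ, (mul_inv _).trans (rng_src γ)⟩

/-- The range map onto the unit space. -/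
def r (γ : G) : unitSpace G := ⟨rng γ, rng_mem γ⟩

/-- The source map onto the unit space. -/
def s (γ : G) : unitSpace G := ⟨src γ, src_mem γ⟩

lemma rng_unit {u : G} (hu : u ∈ unitSpace G) : rng u = u := by
  obtain ⟨γ, rfl⟩ := hu; simp only [mul_inv, rng_rng]

lemma src_unit {u : G} (hu : u ∈ unitSpace G) : src u = u := by
  obtain ⟨γ, rfl⟩ := hu; simp only [mul_inv, src_rng]

lemma inv_mul_cancel_left {a b : G} (h : rng a = rng b) : a * (a⁻¹ * b) = b := by
  rw [← mul_assoc _ _ _ (rng_inv a).symm ((src_inv a).trans h), mul_inv, h, rng_mul_self]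

lemma mul_inv_cancel_left {a b : G} (h : src a = rng b) : a⁻¹ * (a * b) = b := by
  rw [← mul_assoc _ _ _ (src_inv a) h, inv_mul, h, rng_mul_self]

lemma mul_inv_cancel_right {a b : G} (h : src a = src b) : a * b⁻¹ * b = a := by
  rw [mul_assoc _ _ _ (h.trans (rng_inv b).symm) (src_inv b), inv_mul, ← h, self_mul_src]

lemma mul_mul_inv_cancel {a b : G} (h : src a = rng b) : a * b * b⁻¹ = a := by
  rw [mul_assoc _ _ _ h (rng_inv b).symm, mul_inv, ← h, self_mul_src]

lemma eq_inv_of_mul_mem {a b : G} (h : src a = rng b) (hab : a * b ∈ unitSpace G) : b = a⁻¹ := by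
  have h1 : a * b = rng a := by rw [← rng_unit hab, rng_mul _ _ h]
  have h2 := mul_inv_cancel_left h
  rw [h1, ← src_inv, self_mul_src] at h2
  exact h2.symm

lemma inv_inv_self (a : G) : a⁻¹⁻¹ = a := by
  refine (eq_inv_of_mul_mem (src_inv a) ?_).symm
  rw [inv_mul]; exact src_mem a

lemma inv_mul_rev {a b : G} (h : src a = rng b) : (a * b)⁻¹ = b⁻¹ * a⁻¹ := by
  have h' : src b⁻¹ = rng a⁻¹ := by rw [src_inv, rng_inv, h]
  symm
  apply eq_inv_of_mul_mem
  · rw [src_mul _ _ h, rng_mul _ _ h', rng_inv]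
  · rw [← mul_assoc (a * b) b⁻¹ a⁻¹ (by rw [src_mul _ _ h, rng_inv]) h', mul_mul_inv_cancel h, mul_inv]
    exact rng_mem a

/-- The arrows with source `u`. -/
abbrev SrcFiber (u : G) : Type _ := {γ : G // src γ = u}

/-- The arrows with range `u`. -/
abbrev RngFiber (u : G) : Type _ := {γ : G // rng γ = u}

variable (G) in
/-- A topological groupoid is topologically principal if the units with trivial isotropy are dense
in the unit space. -/
def IsTopologicallyPrincipal [TopologicalSpace G] : Prop :=
  Dense {u : unitSpace G | {γ : G | r γ = u ∧ s γ = u} = {(u : G)}}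

/-- A set `D` of units is invariant if `s γ ∈ D` implies `r γ ∈ D`. -/
def IsInvariant (D : Set (unitSpace G)) : Prop := ∀ γ : G, s γ ∈ D → r γ ∈ D

variable (G) in
/-- A topological groupoid is minimal if its unit space has no nontrivial open invariant
subsets. -/
def IsMinimal [TopologicalSpace G] : Prop :=
  ∀ U : Set (unitSpace G), IsOpen U → IsInvariant U → U = ∅ ∨ U = Set.univ

end ArrowGroupoid

open ArrowGroupoid in
/-- An étale groupoid: range, source and composition are continuous, and range and source are local
homeomorphisms onto the unit space (with its subspace topology). Continuity of inversion follows;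
see `ArrowGroupoid.continuous_inversion`. -/
class EtaleGroupoid (G : Type*) [TopologicalSpace G] extends ArrowGroupoid G where
  continuous_r : Continuous (r : G → unitSpace G)
  continuous_s : Continuous (s : G → unitSpace G)
  continuousOn_mul : ContinuousOn (fun p : G × G => p.1 * p.2) {p | src p.1 = rng p.2}
  isLocalHomeomorph_r : IsLocalHomeomorph (r : G → unitSpace G)
  isLocalHomeomorph_s : IsLocalHomeomorph (s : G → unitSpace G)

namespace ArrowGroupoid

open Topology

variable {G : Type*} [TopologicalSpace G] [EtaleGroupoid G]

lemma continuous_rng : Continuous (rng : G → G) :=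
  continuous_subtype_val.comp EtaleGroupoid.continuous_r

lemma continuous_src : Continuous (src : G → G) :=
  continuous_subtype_val.comp EtaleGroupoid.continuous_s

variable (G) in
lemma isOpen_unitSpace : IsOpen (unitSpace G) := by
  rw [isOpen_iff_mem_nhds]
  intro u hu
  obtain ⟨e, hue, he⟩ := EtaleGroupoid.isLocalHomeomorph_r (G := G) u
  have h1 : e.source ∈ 𝓝 u := e.open_source.mem_nhds hue
  have h2 : rng ⁻¹' e.source ∈ 𝓝 u :=
    continuous_rng.continuousAt.preimage_mem_nhds (by rw [rng_unit hu]; exact h1)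
  filter_upwards [h1, h2] with γ hγ hγ'
  have : γ = rng γ := e.injOn hγ hγ' (by rw [← he]; exact Subtype.ext (rng_rng γ).symm)
  rw [this]
  exact rng_mem γ

lemma isLocalHomeomorph_rng : IsLocalHomeomorph (rng : G → G) :=
  (isOpen_unitSpace G).isOpenEmbedding_subtypeVal.isLocalHomeomorph.comp
    EtaleGroupoid.isLocalHomeomorph_r

lemma isLocalHomeomorph_src : IsLocalHomeomorph (src : G → G) :=
  (isOpen_unitSpace G).isOpenEmbedding_subtypeVal.isLocalHomeomorph.comp
    EtaleGroupoid.isLocalHomeomorph_s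

/-- Inversion is continuous. -/
lemma continuous_inversion : Continuous fun γ : G => γ⁻¹ := by
  rw [continuous_iff_continuousAt]
  intro γ₀
  obtain ⟨e, hue, he⟩ := isLocalHomeomorph_rng (G := G) γ₀⁻¹
  have hsrc : src γ₀ = e γ₀⁻¹ := by rw [← he, rng_inv]
  have ht : src γ₀ ∈ e.target := hsrc ▸ e.map_source hue
  set η : G → G := fun γ => e.symm (src γ) with hη
  have hηc : ContinuousAt η γ₀ :=
    (e.continuousAt_symm ht).comp continuous_src.continuousAt
  have hη0 : η γ₀ = γ₀⁻¹ := by rw [hη]; simp only; rw [hsrc, e.left_inv hue]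
  have hev : ∀ᶠ γ in 𝓝 γ₀, src γ ∈ e.target :=
    continuous_src.continuousAt.preimage_mem_nhds (e.open_target.mem_nhds ht)
  have hcomp : ∀ᶠ γ in 𝓝 γ₀, src γ = rng (η γ) := by
    filter_upwards [hev] with γ hγ
    rw [he, hη, e.right_inv hγ]
  have hmul : Filter.Tendsto (fun γ => γ * η γ) (𝓝 γ₀) (𝓝 (γ₀ * η γ₀)) :=
    (EtaleGroupoid.continuousOn_mul (G := G) (γ₀, η γ₀) hcomp.self_of_nhds).tendsto.comp
      (tendsto_nhdsWithin_iff.2 ⟨(continuousAt_id.prodMk hηc), hcomp⟩)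
  have hunit : ∀ᶠ γ in 𝓝 γ₀, γ * η γ ∈ unitSpace G := by
    apply hmul
    apply (isOpen_unitSpace G).mem_nhds
    rw [hη0]; exact ⟨γ₀, rfl⟩
  refine ContinuousAt.congr hηc ?_
  filter_upwards [hcomp, hunit] with γ h1 h2 using eq_inv_of_mul_mem h1 h2

lemma finite_inter_rng [T1Space G] {K : Set G} (hK : IsCompact K) (u : G) :
    (K ∩ rng ⁻¹' {u}).Finite := by
  have hS : IsCompact (K ∩ rng ⁻¹' {u}) :=
    hK.inter_right (isClosed_singleton.preimage continuous_rng)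
  apply hS.finite
  apply isLocalHomeomorph_rng.isLocalHomeomorphOn.mono (Set.subset_univ _) |>.isDiscrete_of_image
  refine Set.Subsingleton.isDiscrete ?_
  rintro _ ⟨a, ha, rfl⟩ _ ⟨b, hb, rfl⟩
  exact ha.2.trans hb.2.symm

/-- Summing over range fibres a function with compact support along the fibres gives a continuous
function. -/
lemma continuous_tsum_rngFiber [T2Space G] {Y E : Type*} [TopologicalSpace Y] [AddCommMonoid E]
    [TopologicalSpace E] [ContinuousAdd E] {ρ : Y → G} (hρ : Continuous ρ) {K : Set G}
    (hK : IsCompact K) (F : G → Y → E)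
    (hF : ContinuousOn (fun p : G × Y => F p.1 p.2) {p | rng p.1 = ρ p.2})
    (hF0 : ∀ α y, rng α = ρ y → α ∉ K → F α y = 0) :
    Continuous fun y => ∑' α : RngFiber (ρ y), F α y := by
  classical
  rw [continuous_iff_continuousAt]
  intro y₀
  have hfin := finite_inter_rng hK (ρ y₀)
  set S := hfin.toFinset with hS
  have hSmem : ∀ α, α ∈ S ↔ α ∈ K ∧ rng α = ρ y₀ := fun α => by simp [hS]
  obtain ⟨U, hU, hdisj⟩ := hfin.t2_separation
  choose e hxe he using fun α : G => isLocalHomeomorph_rng (G := G) α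
  set W : G → Set G := fun α => U α ∩ (e α).source with hW
  have hWo : ∀ α, IsOpen (W α) := fun α => (hU α).2.inter (e α).open_source
  have hWm : ∀ α, α ∈ W α := fun α => ⟨(hU α).1, hxe α⟩
  have hK' : IsCompact (K \ ⋃ α ∈ S, W α) := hK.diff (isOpen_biUnion fun α _ => hWo α)
  have hc : IsClosed (rng '' (K \ ⋃ α ∈ S, W α)) := (hK'.image continuous_rng).isClosed
  have h1 : ∀ᶠ y in 𝓝 y₀, ρ y ∉ rng '' (K \ ⋃ α ∈ S, W α) := by
    refine hρ.continuousAt.preimage_mem_nhds (hc.isOpen_compl.mem_nhds ?_)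
    rintro ⟨α, ⟨hαK, hα⟩, hαy⟩
    exact hα (Set.mem_biUnion (show α ∈ S from (hSmem α).2 ⟨hαK, hαy⟩) (hWm α))
  have h2 : ∀ᶠ y in 𝓝 y₀, ∀ α ∈ S, ρ y ∈ e α '' W α := by
    rw [Filter.eventually_all_finset]
    intro α hα
    refine hρ.continuousAt.preimage_mem_nhds (IsOpen.mem_nhds ?_ ?_)
    · exact (e α).isOpen_image_of_subset_source (hWo α) Set.inter_subset_right
    · refine ⟨α, hWm α, ?_⟩
      rw [← he]; exact ((hSmem α).1 hα).2
  have key : ∀ᶠ y in 𝓝 y₀,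
      ∑ α ∈ S, F ((e α).symm (ρ y)) y = ∑' α : RngFiber (ρ y), F α y := by
    filter_upwards [h1, h2] with y hy1 hy2
    have hσW : ∀ α ∈ S, (e α).symm (ρ y) ∈ W α := by
      intro α hα
      obtain ⟨w, hw, hwy⟩ := hy2 α hα
      rw [← hwy, (e α).left_inv hw.2]; exact hw
    have hσr : ∀ α ∈ S, rng ((e α).symm (ρ y)) = ρ y := by
      intro α hα
      obtain ⟨w, hw, hwy⟩ := hy2 α hα
      rw [← hwy, (e α).left_inv hw.2]; exact congrFun (he α) w
    have hinj : Set.InjOn (fun α => (e α).symm (ρ y)) S := by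
      intro α hα β hβ hab
      by_contra hne
      have := hdisj (show α ∈ _ by simpa [hS] using hα) (show β ∈ _ by simpa [hS] using hβ) hne
      refine Set.disjoint_left.1 this (hσW α hα).1 ?_
      simp only at hab
      rw [hab]; exact (hσW β hβ).1
    have htsum : ∑' α : RngFiber (ρ y), F α y
        = ∑' α : G, Set.indicator {α | rng α = ρ y} (fun α => F α y) α :=
      tsum_subtype {α : G | rng α = ρ y} fun α => F α y
    rw [htsum, tsum_eq_sum (s := S.image fun α => (e α).symm (ρ y)), Finset.sum_image hinj]
    · refine Finset.sum_congr rfl fun α hα => ?_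
      rw [Set.indicator_of_mem]
      exact hσr α hα
    · intro β hβ
      by_cases hβr : rng β = ρ y
      · rw [Set.indicator_of_mem (show β ∈ {α | rng α = ρ y} from hβr)]
        by_cases hβK : β ∈ K
        · exfalso
          by_cases hβW : β ∈ ⋃ α ∈ S, W α
          · simp only [Set.mem_iUnion] at hβW
            obtain ⟨α, hα, hβα⟩ := hβW
            refine hβ (Finset.mem_image.2 ⟨α, hα, ?_⟩)
            have : ρ y = e α β := by rw [← hβr, ← he α]
            rw [this, (e α).left_inv hβα.2]
          · exact hy1 ⟨β, ⟨hβK, hβW⟩, hβr⟩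
        · exact hF0 β y hβr hβK
      · rw [Set.indicator_of_notMem (show β ∉ {α | rng α = ρ y} from hβr)]
  refine ContinuousAt.congr ?_ key
  refine tendsto_finsetSum _ fun α hα => ?_
  have hα' := (hSmem α).1 hα
  have hρα : ρ y₀ = e α α := by rw [← hα'.2, ← he α]
  have hσ0 : (e α).symm (ρ y₀) = α := by rw [hρα, (e α).left_inv (hxe α)]
  have htar : ρ y₀ ∈ (e α).target := hρα ▸ (e α).map_source (hxe α)
  have hσc : ContinuousAt (fun y => (e α).symm (ρ y)) y₀ :=
    ((e α).continuousAt_symm htar).comp hρ.continuousAt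
  refine (hF ((e α).symm (ρ y₀), y₀) ?_).tendsto.comp
    (tendsto_nhdsWithin_iff.2 ⟨hσc.prodMk continuousAt_id, ?_⟩)
  · change rng ((e α).symm (ρ y₀)) = ρ y₀
    rw [hσ0]; exact hα'.2
  · filter_upwards [hρ.continuousAt.preimage_mem_nhds ((e α).open_target.mem_nhds htar)] with y hy
    change rng ((e α).symm (ρ y)) = ρ y
    conv_lhs => rw [he α]
    exact (e α).right_inv hy

end ArrowGroupoid

/-! ## The convolution algebra -/

/-- The vector space `C_c(G)` of compactly supported continuous complex functions on `G`; it is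
given the convolution product and the involution of the groupoid below. -/
def ConvAlgebra (G : Type*) [TopologicalSpace G] : Type _ := CompactlySupportedContinuousMap G ℂ

namespace ConvAlgebra

set_option linter.unusedSectionVars false

open ArrowGroupoid

section Basic

variable {G : Type*} [TopologicalSpace G]

noncomputable instance : AddCommGroup (ConvAlgebra G) :=
  inferInstanceAs (AddCommGroup (CompactlySupportedContinuousMap G ℂ))
noncomputable instance : Module ℂ (ConvAlgebra G) :=
  inferInstanceAs (Module ℂ (CompactlySupportedContinuousMap G ℂ))
instance : FunLike (ConvAlgebra G) G ℂ :=
  inferInstanceAs (FunLike (CompactlySupportedContinuousMap G ℂ) G ℂ)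

/-- Build an element of `C_c(G)` from a function. -/
def mk' (f : G → ℂ) (hf : Continuous f) (hc : HasCompactSupport f) : ConvAlgebra G :=
  (⟨⟨f, hf⟩, hc⟩ : CompactlySupportedContinuousMap G ℂ)

@[simp] lemma mk'_apply (f : G → ℂ) (hf hc) (γ : G) : mk' f hf hc γ = f γ := rfl
@[simp] lemma add_apply (f g : ConvAlgebra G) (γ : G) : (f + g) γ = f γ + g γ := rfl
@[simp] lemma smul_apply (c : ℂ) (f : ConvAlgebra G) (γ : G) : (c • f) γ = c * f γ := rfl
@[simp] lemma zero_apply (γ : G) : (0 : ConvAlgebra G) γ = 0 := rfl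

@[ext] lemma ext {f g : ConvAlgebra G} (h : ∀ γ, f γ = g γ) : f = g := DFunLike.ext f g h

lemma continuous (f : ConvAlgebra G) : Continuous f :=
  ContinuousMap.continuous (CompactlySupportedContinuousMap.toContinuousMap (α := G) (β := ℂ) f)

lemma isCompact (f : ConvAlgebra G) : IsCompact (tsupport f) :=
  CompactlySupportedContinuousMap.hasCompactSupport' f

lemma notMem {f : ConvAlgebra G} {γ : G} (h : γ ∉ tsupport f) : f γ = 0 :=
  image_eq_zero_of_notMem_tsupport h

end Basic

variable {G : Type*} [TopologicalSpace G] [EtaleGroupoid G] [T2Space G]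

/-- The function `(f * g)(γ) = ∑_{r(α) = r(γ)} f(α) g(α⁻¹ γ)`; the sum has finitely many nonzero
terms. -/
noncomputable def convFun (f g : ConvAlgebra G) (γ : G) : ℂ :=
  ∑' α : RngFiber (rng γ), f α * g ((α : G)⁻¹ * γ)

lemma continuousOn_inv_mul :
    ContinuousOn (fun p : G × G => p.1⁻¹ * p.2) {p | rng p.1 = rng p.2} := by
  have h : ContinuousOn (fun p : G × G => (p.1⁻¹, p.2)) {p | rng p.1 = rng p.2} :=
    ((continuous_inversion.comp continuous_fst).prodMk continuous_snd).continuousOn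
  exact EtaleGroupoid.continuousOn_mul.comp h fun p hp => (src_inv p.1).trans hp

lemma continuous_convFun (f g : ConvAlgebra G) : Continuous (convFun f g) := by
  refine continuous_tsum_rngFiber continuous_rng f.isCompact
    (fun α γ => f α * g (α⁻¹ * γ)) ?_ ?_
  · exact (f.continuous.comp continuous_fst).continuousOn.mul
      (g.continuous.comp_continuousOn continuousOn_inv_mul)
  · intro α γ _ hα
    rw [notMem hα, zero_mul]

lemma hasCompactSupport_convFun (f g : ConvAlgebra G) : HasCompactSupport (convFun f g) := by
  set Z : Set (G × G) := (tsupport f ×ˢ tsupport g) ∩ {p | src p.1 = rng p.2}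
  have hZ : IsCompact Z := (f.isCompact.prod g.isCompact).inter_right
    (isClosed_eq (continuous_src.comp continuous_fst) (continuous_rng.comp continuous_snd))
  have hK : IsCompact ((fun p : G × G => p.1 * p.2) '' Z) :=
    hZ.image_of_continuousOn (EtaleGroupoid.continuousOn_mul.mono Set.inter_subset_right)
  refine HasCompactSupport.intro hK fun γ hγ => ?_
  rw [convFun]
  refine (tsum_congr fun α => ?_).trans tsum_zero
  by_contra hne
  have hα : (α : G) ∈ tsupport f := by
    by_contra h; exact hne (by rw [notMem h, zero_mul])
  have hβ : (α : G)⁻¹ * γ ∈ tsupport g := by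
    by_contra h; exact hne (by rw [notMem h, mul_zero])
  refine hγ ⟨(α, (α : G)⁻¹ * γ), ⟨⟨hα, hβ⟩, ?_⟩, inv_mul_cancel_left α.2⟩
  change src (α : G) = rng ((α : G)⁻¹ * γ)
  rw [rng_mul _ _ ((src_inv _).trans α.2), rng_inv]

noncomputable instance : Mul (ConvAlgebra G) :=
  ⟨fun f g => mk' (convFun f g) (continuous_convFun f g) (hasCompactSupport_convFun f g)⟩

lemma mul_apply (f g : ConvAlgebra G) (γ : G) :
    (f * g) γ = ∑' α : RngFiber (rng γ), f α * g ((α : G)⁻¹ * γ) := rfl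

/-- The involution `f*(γ) = conj (f (γ⁻¹))`. -/
noncomputable instance : Star (ConvAlgebra G) :=
  ⟨fun f => mk' (fun γ => star (f γ⁻¹)) (f.continuous.comp continuous_inversion).star (by
    refine HasCompactSupport.intro (f.isCompact.image continuous_inversion) fun γ hγ => ?_
    have : γ⁻¹ ∉ tsupport f := fun h => hγ ⟨γ⁻¹, h, inv_inv_self γ⟩
    rw [notMem this, star_zero])⟩

lemma star_apply (f : ConvAlgebra G) (γ : G) : star f γ = star (f γ⁻¹) := rfl

/-! ### Matrix kernels: `f` acts on functions on a source fibre by `f (γ β⁻¹)` -/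

/-- The kernel `(γ, β) ↦ f (γ β⁻¹)` on the source fibre of `u`. -/
def ker (f : ConvAlgebra G) (u : G) (γ β : SrcFiber u) : ℂ := f ((γ : G) * (β : G)⁻¹)

lemma comp_aux {u : G} (γ β : SrcFiber u) : src (γ : G) = rng (β : G)⁻¹ := by
  rw [rng_inv, γ.2, β.2]

/-- `α ↦ α⁻¹ γ` from arrows with range `r γ` to arrows with source `u = s γ`. -/
def rngEquiv {u : G} (γ : SrcFiber u) : RngFiber (rng (γ : G)) ≃ SrcFiber u where
  toFun α := ⟨(α : G)⁻¹ * γ, by rw [src_mul _ _ ((src_inv _).trans α.2), γ.2]⟩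
  invFun β := ⟨(γ : G) * (β : G)⁻¹, rng_mul _ _ (comp_aux γ β)⟩
  left_inv α := Subtype.ext <| by
    have h1 : src (α : G)⁻¹ = rng (γ : G) := (src_inv _).trans α.2
    simp only
    rw [inv_mul_rev h1, inv_inv_self, inv_mul_cancel_left α.2.symm]
  right_inv β := Subtype.ext <| by
    simp only
    rw [inv_mul_rev (comp_aux γ β), inv_inv_self, mul_inv_cancel_right (β.2.trans γ.2.symm)]

/-- `γ ↦ γ β⁻¹` from arrows with source `u = s β` to arrows with source `r β`. -/
def srcEquiv {u : G} (β : SrcFiber u) : SrcFiber u ≃ SrcFiber (rng (β : G)) where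
  toFun γ := ⟨(γ : G) * (β : G)⁻¹, by rw [src_mul _ _ (comp_aux γ β), src_inv]⟩
  invFun α := ⟨(α : G) * β, by rw [src_mul _ _ α.2, β.2]⟩
  left_inv γ := Subtype.ext (mul_inv_cancel_right (γ.2.trans β.2.symm))
  right_inv α := Subtype.ext (mul_mul_inv_cancel α.2)

lemma finite_rngFiber (f : ConvAlgebra G) (u : G) :
    (Function.support fun α : RngFiber u => f α).Finite := by
  refine Set.Finite.of_finite_image (f := Subtype.val)
    ((finite_inter_rng f.isCompact u).subset ?_) Subtype.val_injective.injOn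
  rintro _ ⟨α, hα, rfl⟩
  exact ⟨subset_tsupport _ hα, α.2⟩

/-- Inversion as a bijection from source to range fibres. -/
def invEquiv (u : G) : SrcFiber u ≃ RngFiber u where
  toFun γ := ⟨(γ : G)⁻¹, (rng_inv _).trans γ.2⟩
  invFun γ := ⟨(γ : G)⁻¹, (src_inv _).trans γ.2⟩
  left_inv _ := Subtype.ext (inv_inv_self _)
  right_inv _ := Subtype.ext (inv_inv_self _)

lemma finite_srcFiber (f : ConvAlgebra G) (u : G) :
    (Function.support fun α : SrcFiber u => f α).Finite := by
  have := (finite_rngFiber (star f) u).preimage (f := invEquiv u) (invEquiv u).injective.injOn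
  refine this.subset fun α hα => ?_
  simp only [Set.mem_preimage, Function.mem_support, star_apply, invEquiv, Equiv.coe_fn_mk, inv_inv_self]
  exact star_ne_zero.2 hα

lemma finite_ker_row (f : ConvAlgebra G) {u : G} (γ : SrcFiber u) :
    (Function.support fun β => ker f u γ β).Finite :=
  (finite_rngFiber f (rng (γ : G))).preimage (f := (rngEquiv γ).symm)
    (rngEquiv γ).symm.injective.injOn

lemma finite_ker_col (f : ConvAlgebra G) {u : G} (β : SrcFiber u) :
    (Function.support fun γ => ker f u γ β).Finite :=
  (finite_srcFiber f (rng (β : G))).preimage (f := srcEquiv β) (srcEquiv β).injective.injOn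

lemma mul_apply_fiber (f g : ConvAlgebra G) {u : G} (γ : SrcFiber u) :
    (f * g) γ = ∑' δ : SrcFiber u, ker f u γ δ * g δ := by
  rw [mul_apply, ← (rngEquiv γ).symm.tsum_eq]
  refine tsum_congr fun δ => ?_
  have : ((((rngEquiv γ).symm δ : RngFiber (rng (γ : G))) : G)⁻¹ * γ)
      = ((rngEquiv γ ((rngEquiv γ).symm δ) : SrcFiber u) : G) := rfl
  rw [this, Equiv.apply_symm_apply]
  rfl

lemma ker_mul (f g : ConvAlgebra G) {u : G} (γ β : SrcFiber u) :
    ker (f * g) u γ β = ∑' δ : SrcFiber u, ker f u γ δ * ker g u δ β := by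
  have h := mul_apply_fiber f g (srcEquiv β γ)
  change (f * g) ((srcEquiv β γ : SrcFiber _) : G) = _
  rw [h, ← (srcEquiv β).tsum_eq]
  refine tsum_congr fun δ => ?_
  change f _ * g _ = f _ * g _
  congr 2
  change ((γ : G) * (β : G)⁻¹) * ((δ : G) * (β : G)⁻¹)⁻¹ = (γ : G) * (δ : G)⁻¹
  rw [inv_mul_rev (comp_aux δ β), inv_inv_self, ← ArrowGroupoid.mul_assoc _ (β : G), mul_inv_cancel_right (γ.2.trans β.2.symm)]
  · rw [src_mul _ _ (comp_aux γ β), src_inv]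
  · exact comp_aux β δ

lemma ker_star (f : ConvAlgebra G) {u : G} (γ β : SrcFiber u) :
    ker (star f) u γ β = star (ker f u β γ) := by
  rw [ker, star_apply, inv_mul_rev (comp_aux γ β), inv_inv_self]; rfl

/-- A unit in its own source fibre. -/
def unitFiber (γ : G) : SrcFiber (src γ) := ⟨src γ, src_src γ⟩

lemma inv_src (γ : G) : (src γ)⁻¹ = src γ := by
  have := mul_inv_cancel_left (a := src γ) (b := (src γ)) (by rw [src_src, rng_src])
  conv_lhs => rw [← self_mul_src (src γ)⁻¹, src_inv, rng_src]
  rw [inv_mul, src_src]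

lemma apply_eq_ker (f : ConvAlgebra G) (γ : G) : f γ = ker f (src γ) ⟨γ, rfl⟩ (unitFiber γ) := by
  rw [ker, unitFiber]; simp only; rw [inv_src, self_mul_src]

lemma ext_ker {f g : ConvAlgebra G}
    (h : ∀ (u : G) (γ β : SrcFiber u), ker f u γ β = ker g u γ β) : f = g :=
  ext fun γ => by rw [apply_eq_ker, apply_eq_ker, h]

lemma summable_row (f : ConvAlgebra G) {u : G} (γ : SrcFiber u) (x : SrcFiber u → ℂ) :
    Summable fun δ => ker f u γ δ * x δ :=
  summable_of_hasFiniteSupport ((finite_ker_row f γ).subset (Function.support_mul_subset_left _ _))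

lemma tsum_ker_assoc (f g : ConvAlgebra G) {u : G} (γ : SrcFiber u) (x : SrcFiber u → ℂ) :
    ∑' δ, (∑' ε, ker f u γ ε * ker g u ε δ) * x δ
      = ∑' ε, ker f u γ ε * ∑' δ, ker g u ε δ * x δ := by
  classical
  have hs : ∀ y : SrcFiber u → ℂ, ∑' ε, ker f u γ ε * y ε
      = ∑ ε ∈ (finite_ker_row f γ).toFinset, ker f u γ ε * y ε := fun y =>
    tsum_eq_sum fun ε hε => by
      have : ker f u γ ε = 0 := by simpa using hε
      rw [this, zero_mul]
  simp_rw [hs, Finset.sum_mul]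
  rw [Summable.tsum_finsetSum]
  · refine Finset.sum_congr rfl fun ε _ => ?_
    rw [← tsum_mul_left]
    exact tsum_congr fun δ => _root_.mul_assoc _ _ _
  · intro ε _
    simp_rw [_root_.mul_assoc]
    exact (summable_row g ε x).mul_left _

noncomputable instance : NonUnitalRing (ConvAlgebra G) where
  left_distrib f g h := ext_ker fun u γ β => by
    have h1 : ker (f * g + f * h) u γ β = ker (f * g) u γ β + ker (f * h) u γ β := rfl
    rw [h1, ker_mul, ker_mul, ker_mul, ← (summable_row f γ _).tsum_add (summable_row f γ _)]
    exact tsum_congr fun δ => mul_add _ _ _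
  right_distrib f g h := ext_ker fun u γ β => by
    have h1 : ker (f * h + g * h) u γ β = ker (f * h) u γ β + ker (g * h) u γ β := rfl
    rw [h1, ker_mul, ker_mul, ker_mul, ← (summable_row f γ _).tsum_add (summable_row g γ _)]
    exact tsum_congr fun δ => add_mul _ _ _
  zero_mul f := ext fun γ => by simp [mul_apply]
  mul_zero f := ext fun γ => by simp [mul_apply]
  mul_assoc f g h := ext_ker fun u γ β => by
    rw [ker_mul, ker_mul]
    simp_rw [ker_mul]
    exact tsum_ker_assoc f g γ _

instance : IsScalarTower ℂ (ConvAlgebra G) (ConvAlgebra G) where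
  smul_assoc c f g := ext fun γ => by
    simp only [smul_eq_mul, mul_apply, smul_apply, _root_.mul_assoc, tsum_mul_left]

instance : SMulCommClass ℂ (ConvAlgebra G) (ConvAlgebra G) where
  smul_comm c f g := ext fun γ => by
    simp only [smul_eq_mul, mul_apply, smul_apply, mul_left_comm _ c, tsum_mul_left]

noncomputable instance : StarRing (ConvAlgebra G) where
  star_involutive f := ext fun γ => by simp [star_apply, inv_inv_self]
  star_add f g := ext fun γ => by simp [star_apply]
  star_mul f g := ext_ker fun u γ β => by
    rw [ker_star, ker_mul, ker_mul, tsum_star]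
    exact tsum_congr fun δ => by rw [star_mul, ker_star, ker_star]

instance : StarModule ℂ (ConvAlgebra G) where
  star_smul c f := ext fun γ => by simp [star_apply]

/-! ### The `I`-norm -/

/-- The `I`-norm on `C_c(G)`. -/
noncomputable def iNorm (f : ConvAlgebra G) : ℝ :=
  ⨆ u : unitSpace G,
    max (∑' γ : SrcFiber (u : G), ‖f γ‖) (∑' γ : RngFiber (u : G), ‖f γ‖)

lemma tsum_src_eq_star (f : ConvAlgebra G) (u : G) :
    ∑' γ : SrcFiber u, ‖f γ‖ = ∑' γ : RngFiber u, ‖star f γ‖ := by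
  rw [← (invEquiv u).tsum_eq]
  exact tsum_congr fun γ => by
    rw [star_apply, norm_star]; simp only [invEquiv, Equiv.coe_fn_mk, inv_inv_self]

lemma bddAbove_rng (f : ConvAlgebra G) :
    BddAbove (Set.range fun u : unitSpace G => ∑' γ : RngFiber (u : G), ‖f γ‖) := by
  have hc : Continuous fun u : unitSpace G => ∑' γ : RngFiber (u : G), ‖f γ‖ := by
    refine continuous_tsum_rngFiber continuous_subtype_val f.isCompact (fun α _ => ‖f α‖) ?_ ?_
    · exact (f.continuous.norm.comp continuous_fst).continuousOn
    · intro α _ _ hα; rw [notMem hα, norm_zero]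
  have hK : IsCompact (r '' tsupport f) := f.isCompact.image EtaleGroupoid.continuous_r
  obtain ⟨M, hM⟩ := (hK.image hc).bddAbove
  refine ⟨max M 0, ?_⟩
  rintro _ ⟨u, rfl⟩
  by_cases hu : u ∈ r '' tsupport f
  · exact (hM ⟨u, hu, rfl⟩).trans (le_max_left _ _)
  · refine le_trans (le_of_eq ?_) (le_max_right _ _)
    refine (tsum_congr fun γ => ?_).trans tsum_zero
    rw [notMem fun h => hu ⟨γ, h, Subtype.ext γ.2⟩, norm_zero]

lemma bddAbove_iNorm (f : ConvAlgebra G) :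
    BddAbove (Set.range fun u : unitSpace G =>
      max (∑' γ : SrcFiber (u : G), ‖f γ‖) (∑' γ : RngFiber (u : G), ‖f γ‖)) := by
  obtain ⟨M, hM⟩ := bddAbove_rng f
  obtain ⟨N, hN⟩ := bddAbove_rng (star f)
  refine ⟨max N M, ?_⟩
  rintro _ ⟨u, rfl⟩
  refine max_le_max ?_ (hM ⟨u, rfl⟩)
  rw [tsum_src_eq_star]; exact hN ⟨u, rfl⟩

lemma iNorm_nonneg (f : ConvAlgebra G) : 0 ≤ iNorm f :=
  Real.iSup_nonneg fun _ => le_max_of_le_left (tsum_nonneg fun _ => norm_nonneg _)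

lemma tsum_src_le (f : ConvAlgebra G) {u : G} (hu : u ∈ unitSpace G) :
    ∑' γ : SrcFiber u, ‖f γ‖ ≤ iNorm f :=
  (le_max_left _ _).trans (le_ciSup (bddAbove_iNorm f) ⟨u, hu⟩)

lemma tsum_rng_le (f : ConvAlgebra G) {u : G} (hu : u ∈ unitSpace G) :
    ∑' γ : RngFiber u, ‖f γ‖ ≤ iNorm f :=
  (le_max_right _ _).trans (le_ciSup (bddAbove_iNorm f) ⟨u, hu⟩)

lemma summable_norm_src (f : ConvAlgebra G) (u : G) : Summable fun γ : SrcFiber u => ‖f γ‖ :=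
  summable_of_hasFiniteSupport ((finite_srcFiber f u).subset fun _ h => norm_ne_zero_iff.1 h)

lemma summable_norm_row (f : ConvAlgebra G) {u : G} (γ : SrcFiber u) :
    Summable fun β => ‖ker f u γ β‖ :=
  summable_of_hasFiniteSupport ((finite_ker_row f γ).subset fun _ h => norm_ne_zero_iff.1 h)

lemma summable_norm_col (f : ConvAlgebra G) {u : G} (β : SrcFiber u) :
    Summable fun γ => ‖ker f u γ β‖ :=
  summable_of_hasFiniteSupport ((finite_ker_col f β).subset fun _ h => norm_ne_zero_iff.1 h)

lemma tsum_row_le (f : ConvAlgebra G) {u : G} (γ : SrcFiber u) :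
    ∑' β, ‖ker f u γ β‖ ≤ iNorm f := by
  rw [← (rngEquiv γ).tsum_eq]
  refine le_trans (le_of_eq (tsum_congr fun α => ?_)) (tsum_rng_le f (rng_mem (γ : G)))
  have : ker f u γ (rngEquiv γ α) = f ((rngEquiv γ).symm (rngEquiv γ α) : RngFiber (rng (γ : G))) := rfl
  rw [this, Equiv.symm_apply_apply]

lemma tsum_col_le (f : ConvAlgebra G) {u : G} (β : SrcFiber u) :
    ∑' γ, ‖ker f u γ β‖ ≤ iNorm f :=
  ((srcEquiv β).tsum_eq fun α => ‖f α‖).trans_le (tsum_src_le f (rng_mem (β : G)))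

lemma enorm_col_le (f : ConvAlgebra G) {u : G} (β : SrcFiber u) :
    ∑' γ, ‖ker f u γ β‖ₑ ≤ ENNReal.ofReal (iNorm f) := by
  simp_rw [← ofReal_norm]
  rw [← ENNReal.ofReal_tsum_of_nonneg (fun _ => norm_nonneg _) (summable_norm_col f β)]
  exact ENNReal.ofReal_le_ofReal (tsum_col_le f β)

lemma enorm_row_le (f : ConvAlgebra G) {u : G} (γ : SrcFiber u) :
    ∑' β, ‖ker f u γ β‖ₑ ≤ ENNReal.ofReal (iNorm f) := by
  simp_rw [← ofReal_norm]
  rw [← ENNReal.ofReal_tsum_of_nonneg (fun _ => norm_nonneg _) (summable_norm_row f γ)]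
  exact ENNReal.ofReal_le_ofReal (tsum_row_le f γ)

lemma enorm_src_le (f : ConvAlgebra G) {u : G} (hu : u ∈ unitSpace G) :
    ∑' γ : SrcFiber u, ‖f γ‖ₑ ≤ ENNReal.ofReal (iNorm f) := by
  simp_rw [← ofReal_norm]
  rw [← ENNReal.ofReal_tsum_of_nonneg (fun _ => norm_nonneg _) (summable_norm_src f u)]
  exact ENNReal.ofReal_le_ofReal (tsum_src_le f hu)

lemma enorm_mul_le (f g : ConvAlgebra G) {u : G} (γ : SrcFiber u) :
    ‖(f * g) γ‖ₑ ≤ ∑' δ, ‖ker f u γ δ‖ₑ * ‖g δ‖ₑ := by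
  rw [mul_apply_fiber]
  refine (enorm_tsum_le_tsum_enorm).trans (le_of_eq (tsum_congr fun δ => ?_))
  rw [enorm_mul]

lemma iNorm_star (f : ConvAlgebra G) : iNorm (star f) = iNorm f := by
  refine iSup_congr fun u => ?_
  rw [tsum_src_eq_star, star_star, tsum_src_eq_star f, max_comm]

lemma tsum_src_mul_le (f g : ConvAlgebra G) {u : G} (hu : u ∈ unitSpace G) :
    ∑' γ : SrcFiber u, ‖(f * g) γ‖ ≤ iNorm f * iNorm g := by
  rw [← ENNReal.ofReal_le_ofReal_iff (mul_nonneg (iNorm_nonneg f) (iNorm_nonneg g)),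
    ENNReal.ofReal_tsum_of_nonneg (fun _ => norm_nonneg _) (summable_norm_src (f * g) u)]
  simp_rw [ofReal_norm]
  calc ∑' γ : SrcFiber u, ‖(f * g) γ‖ₑ
      ≤ ∑' γ : SrcFiber u, ∑' δ, ‖ker f u γ δ‖ₑ * ‖g δ‖ₑ :=
        ENNReal.tsum_le_tsum fun γ => enorm_mul_le f g γ
    _ = ∑' δ, (∑' γ, ‖ker f u γ δ‖ₑ) * ‖g δ‖ₑ := by
        rw [ENNReal.tsum_comm]; simp_rw [ENNReal.tsum_mul_right]
    _ ≤ ∑' δ : SrcFiber u, ENNReal.ofReal (iNorm f) * ‖g δ‖ₑ :=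
        ENNReal.tsum_le_tsum fun δ => mul_le_mul_left (enorm_col_le f δ) _
    _ = ENNReal.ofReal (iNorm f) * ∑' δ : SrcFiber u, ‖g δ‖ₑ := ENNReal.tsum_mul_left
    _ ≤ ENNReal.ofReal (iNorm f) * ENNReal.ofReal (iNorm g) :=
        mul_le_mul_right (enorm_src_le g hu) _
    _ = _ := (ENNReal.ofReal_mul (iNorm_nonneg f)).symm

lemma iNorm_mul_le (f g : ConvAlgebra G) : iNorm (f * g) ≤ iNorm f * iNorm g := by
  refine Real.iSup_le (fun u => max_le (tsum_src_mul_le f g u.2) ?_)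
    (mul_nonneg (iNorm_nonneg f) (iNorm_nonneg g))
  have := tsum_src_mul_le (star g) (star f) u.2
  rw [← star_mul, tsum_src_eq_star, star_star, iNorm_star, iNorm_star, mul_comm] at this
  exact this

end ConvAlgebra

/-! ## The full and the reduced C*-algebra -/

namespace ConvAlgebra

open ArrowGroupoid

set_option linter.unusedSectionVars false

universe u

variable {G : Type u} [TopologicalSpace G] [EtaleGroupoid G] [T2Space G]

/-- The Hilbert space `ℓ²(G_u)`. -/
abbrev L2Fiber (u : G) : Type u := lp (fun _ : SrcFiber u => ℂ) 2

lemma enorm_sq_le (f : ConvAlgebra G) {u : G} (γ : SrcFiber u) (x : SrcFiber u → ℂ) :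
    ‖∑' β, ker f u γ β * x β‖ₑ ^ 2
      ≤ ENNReal.ofReal (iNorm f) * ∑' β, ‖ker f u γ β‖ₑ * ‖x β‖ₑ ^ 2 := by
  classical
  set S := (finite_ker_row f γ).toFinset with hS
  have hz : ∀ β ∉ S, ker f u γ β = 0 := fun β hβ => by simpa [hS] using hβ
  have h1 : ∑' β, ker f u γ β * x β = ∑ β ∈ S, ker f u γ β * x β :=
    tsum_eq_sum fun β hβ => by rw [hz β hβ, zero_mul]
  have h2 : ∑' β, ‖ker f u γ β‖ₑ * ‖x β‖ₑ ^ 2 = ∑ β ∈ S, ‖ker f u γ β‖ₑ * ‖x β‖ₑ ^ 2 :=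
    tsum_eq_sum fun β hβ => by rw [hz β hβ, enorm_zero, zero_mul]
  have h3 : ∑ β ∈ S, ‖ker f u γ β‖ ≤ iNorm f :=
    ((summable_norm_row f γ).sum_le_tsum S fun _ _ => norm_nonneg _).trans (tsum_row_le f γ)
  have h4 : ‖∑ β ∈ S, ker f u γ β * x β‖ ^ 2
      ≤ iNorm f * ∑ β ∈ S, ‖ker f u γ β‖ * ‖x β‖ ^ 2 := by
    calc ‖∑ β ∈ S, ker f u γ β * x β‖ ^ 2
        ≤ (∑ β ∈ S, ‖ker f u γ β‖ * ‖x β‖) ^ 2 := by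
          gcongr
          exact (norm_sum_le _ _).trans (Finset.sum_le_sum fun β _ => (norm_mul _ _).le)
      _ ≤ (∑ β ∈ S, ‖ker f u γ β‖) * ∑ β ∈ S, ‖ker f u γ β‖ * ‖x β‖ ^ 2 :=
          Finset.sum_sq_le_sum_mul_sum_of_sq_le_mul S (fun _ _ => norm_nonneg _)
            (fun _ _ => by positivity) fun _ _ => le_of_eq (by ring)
      _ ≤ _ := by gcongr
  have h5 := ENNReal.ofReal_le_ofReal h4
  rw [ENNReal.ofReal_mul (iNorm_nonneg f), ENNReal.ofReal_sum_of_nonneg (fun _ _ => by positivity),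
    ENNReal.ofReal_pow (norm_nonneg _), ofReal_norm] at h5
  rw [h1, h2]
  refine h5.trans (le_of_eq ?_)
  congr 1
  refine Finset.sum_congr rfl fun β _ => ?_
  rw [ENNReal.ofReal_mul (norm_nonneg _), ENNReal.ofReal_pow (norm_nonneg _), ofReal_norm,
    ofReal_norm]

lemma tsum_enorm_sq_le (f : ConvAlgebra G) {u : G} (x : SrcFiber u → ℂ) :
    ∑' γ, ‖∑' β, ker f u γ β * x β‖ₑ ^ 2 ≤ ENNReal.ofReal (iNorm f) ^ 2 * ∑' β, ‖x β‖ₑ ^ 2 := by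
  calc ∑' γ, ‖∑' β, ker f u γ β * x β‖ₑ ^ 2
      ≤ ∑' γ, ENNReal.ofReal (iNorm f) * ∑' β, ‖ker f u γ β‖ₑ * ‖x β‖ₑ ^ 2 :=
        ENNReal.tsum_le_tsum fun γ => enorm_sq_le f γ x
    _ = ENNReal.ofReal (iNorm f) * ∑' β, (∑' γ, ‖ker f u γ β‖ₑ) * ‖x β‖ₑ ^ 2 := by
        rw [ENNReal.tsum_mul_left, ENNReal.tsum_comm]; simp_rw [ENNReal.tsum_mul_right]
    _ ≤ ENNReal.ofReal (iNorm f) * ∑' β, ENNReal.ofReal (iNorm f) * ‖x β‖ₑ ^ 2 :=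
        mul_le_mul_right (ENNReal.tsum_le_tsum fun β => mul_le_mul_left (enorm_col_le f β) _) _
    _ = _ := by rw [ENNReal.tsum_mul_left]; ring

lemma lp_tsum_enorm {ι : Type*} (x : lp (fun _ : ι => ℂ) 2) :
    ∑' i, ‖x i‖ₑ ^ 2 = ENNReal.ofReal (‖x‖ ^ 2) := by
  have h : HasSum (fun i => ‖x i‖ ^ 2) (‖x‖ ^ 2) := by
    simpa using lp.hasSum_norm (p := 2) (by simp) x
  rw [← h.tsum_eq, ENNReal.ofReal_tsum_of_nonneg (fun _ => by positivity) h.summable]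
  exact tsum_congr fun i => by rw [ENNReal.ofReal_pow (norm_nonneg _), ofReal_norm]

lemma memℓp_of_tsum {ι : Type*} {x : ι → ℂ} (h : ∑' i, ‖x i‖ₑ ^ 2 ≠ ⊤) : Memℓp x 2 := by
  rw [memℓp_gen_iff (by simp)]
  have : Summable fun i => (‖x i‖ₑ ^ 2).toReal := ENNReal.summable_toReal h
  refine this.congr fun i => ?_
  simp [ENNReal.toReal_pow]

/-- The function `γ ↦ ∑_{β ∈ G_u} f (γ β⁻¹) x β` is square summable when `x` is. -/
lemma memℓp_ker (f : ConvAlgebra G) {u : G} (x : L2Fiber u) :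
    Memℓp (fun γ : SrcFiber u => ∑' β : SrcFiber u, f ((γ : G) * (β : G)⁻¹) * x β) 2 := by
  apply memℓp_of_tsum
  refine ne_top_of_le_ne_top ?_ (tsum_enorm_sq_le f x)
  rw [lp_tsum_enorm]
  finiteness

/-- The operator `Ind_u(f)` of convolution by `f` on `ℓ²(G_u)`:
`(Ind_u(f) x)(γ) = ∑_{β ∈ G_u} f (γ β⁻¹) x β`. -/
noncomputable def indOp (u : G) (f : ConvAlgebra G) : L2Fiber u →L[ℂ] L2Fiber u :=
  LinearMap.mkContinuous
    { toFun := fun x =>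
        ⟨fun γ : SrcFiber u => ∑' β : SrcFiber u, f ((γ : G) * (β : G)⁻¹) * x β, memℓp_ker f x⟩
      map_add' := fun x y => lp.ext <| funext fun γ => by
        change ∑' β, ker f u γ β * (x β + y β) = ∑' β, ker f u γ β * x β + ∑' β, ker f u γ β * y β
        rw [← (summable_row f γ _).tsum_add (summable_row f γ _)]
        exact tsum_congr fun β => mul_add _ _ _
      map_smul' := fun c x => lp.ext <| funext fun γ => by
        change ∑' β, ker f u γ β * (c * x β) = c * ∑' β, ker f u γ β * x β
        rw [← tsum_mul_left]
        exact tsum_congr fun β => mul_left_comm _ _ _ }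
    (iNorm f) fun x => by
      have h := tsum_enorm_sq_le f x
      have h2 := lp_tsum_enorm (⟨fun γ : SrcFiber u => ∑' β : SrcFiber u,
        f ((γ : G) * (β : G)⁻¹) * x β, memℓp_ker f x⟩ : L2Fiber u)
      rw [lp_tsum_enorm] at h
      have h3 := h2.symm.trans_le h
      rw [← ENNReal.ofReal_pow (iNorm_nonneg f), ← ENNReal.ofReal_mul (by positivity),
        ← mul_pow, ENNReal.ofReal_le_ofReal_iff (by positivity)] at h3
      exact (sq_le_sq₀ (norm_nonneg _) (mul_nonneg (iNorm_nonneg f) (norm_nonneg _))).1 h3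

lemma indOp_apply (u : G) (f : ConvAlgebra G) (x : L2Fiber u) (γ : SrcFiber u) :
    indOp u f x γ = ∑' β : SrcFiber u, ker f u γ β * x β := rfl

lemma norm_indOp_le (u : G) (f : ConvAlgebra G) : ‖indOp u f‖ ≤ iNorm f :=
  LinearMap.mkContinuous_norm_le _ (iNorm_nonneg f) _

open Classical in
lemma indOp_single (u : G) (f : ConvAlgebra G) (β γ : SrcFiber u) :
    indOp u f (lp.single 2 β (1 : ℂ)) γ = ker f u γ β := by
  rw [indOp_apply, tsum_eq_single β]
  · simp
  · intro δ hδ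
    simp [hδ]

lemma indOp_star (u : G) (f : ConvAlgebra G) : indOp u (star f) = star (indOp u f) := by
  classical
  refine lp.ext_continuousLinearMap (by simp) fun β => ContinuousLinearMap.ext_ring ?_
  refine lp.ext <| funext fun γ => ?_
  have h := lp.inner_single_left (𝕜 := ℂ) γ (1 : ℂ) (star (indOp u f) (lp.single 2 β (1 : ℂ)))
  have h' := lp.inner_single_right (𝕜 := ℂ) β (1 : ℂ) (indOp u f (lp.single 2 γ (1 : ℂ)))
  rw [ContinuousLinearMap.star_eq_adjoint, ContinuousLinearMap.adjoint_inner_right, h'] at h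
  simp only [indOp_single, RCLike.inner_apply, map_one, mul_one, one_mul] at h
  simp only [ContinuousLinearMap.comp_apply, lp.singleContinuousLinearMap_apply]
  rw [indOp_single, ker_star, ContinuousLinearMap.star_eq_adjoint, ← h]
  rfl

/-- The regular representation `Ind_u` of `C_c(G)` on `ℓ²(G_u)`. -/
noncomputable def regularRep (u : G) : ConvAlgebra G →⋆ₙₐ[ℂ] (L2Fiber u →L[ℂ] L2Fiber u) where
  toFun := indOp u
  map_smul' c f := ContinuousLinearMap.ext fun x => lp.ext <| funext fun γ => by
    change ∑' β, c * ker f u γ β * x β = c * ∑' β, ker f u γ β * x β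
    rw [← tsum_mul_left]
    exact tsum_congr fun β => _root_.mul_assoc _ _ _
  map_zero' := ContinuousLinearMap.ext fun x => lp.ext <| funext fun γ => by
    change ∑' β : SrcFiber u, (0 : ℂ) * x β = 0
    simp
  map_add' f g := ContinuousLinearMap.ext fun x => lp.ext <| funext fun γ => by
    change ∑' β, (ker f u γ β + ker g u γ β) * x β
      = ∑' β, ker f u γ β * x β + ∑' β, ker g u γ β * x β
    rw [← (summable_row f γ _).tsum_add (summable_row g γ _)]
    exact tsum_congr fun β => add_mul _ _ _
  map_mul' f g := ContinuousLinearMap.ext fun x => lp.ext <| funext fun γ => by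
    change ∑' β, ker (f * g) u γ β * x β = ∑' ε, ker f u γ ε * ∑' δ, ker g u ε δ * x δ
    simp_rw [ker_mul]
    exact tsum_ker_assoc f g γ _
  map_star' := indOp_star u

variable (G) in
/-- An `I`-norm-bounded `*`-representation of `C_c(G)` on a Hilbert space. -/
structure BoundedRep where
  H : Type u
  [normedAddCommGroup : NormedAddCommGroup H]
  [innerProductSpace : InnerProductSpace ℂ H]
  [completeSpace : CompleteSpace H]
  π : ConvAlgebra G →⋆ₙₐ[ℂ] (H →L[ℂ] H)
  bounded : ∃ C : ℝ, ∀ f, ‖π f‖ ≤ C * iNorm f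

attribute [instance] BoundedRep.normedAddCommGroup BoundedRep.innerProductSpace
  BoundedRep.completeSpace

/-- An `I`-norm-bounded `*`-representation is automatically `I`-norm-decreasing. -/
lemma BoundedRep.norm_le (ρ : BoundedRep G) (f : ConvAlgebra G) : ‖ρ.π f‖ ≤ iNorm f := by
  obtain ⟨C, hC⟩ := ρ.bounded
  set a := star f * f with ha
  have key : ∀ n : ℕ, ∃ b : ConvAlgebra G, star b = b ∧ ‖ρ.π b‖ = ‖ρ.π a‖ ^ 2 ^ n ∧
      iNorm b ≤ iNorm a ^ 2 ^ n := by
    intro n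
    induction n with
    | zero => exact ⟨a, by rw [ha, star_mul, star_star], by simp, by simp⟩
    | succ n ih =>
      obtain ⟨b, hb, h1, h2⟩ := ih
      refine ⟨b * b, by rw [star_mul, hb], ?_, ?_⟩
      · have : ‖ρ.π (star b * b)‖ = ‖ρ.π b‖ * ‖ρ.π b‖ := by
          rw [map_mul, map_star, CStarRing.norm_star_mul_self]
        rw [hb] at this
        rw [this, h1, pow_succ, pow_mul, sq]
      · refine (iNorm_mul_le b b).trans ?_
        rw [pow_succ, pow_mul, sq]
        exact mul_le_mul h2 h2 (iNorm_nonneg b) (pow_nonneg (iNorm_nonneg a) _)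
  have hbound : ∀ n : ℕ, ‖ρ.π a‖ ^ 2 ^ n ≤ max C 0 * iNorm a ^ 2 ^ n := by
    intro n
    obtain ⟨b, -, h1, h2⟩ := key n
    rw [← h1]
    calc ‖ρ.π b‖ ≤ C * iNorm b := hC b
      _ ≤ max C 0 * iNorm b := mul_le_mul_of_nonneg_right (le_max_left _ _) (iNorm_nonneg b)
      _ ≤ _ := mul_le_mul_of_nonneg_left h2 (le_max_right _ _)
  have ha1 : ‖ρ.π a‖ ≤ iNorm a := by
    by_contra! hlt
    rcases (iNorm_nonneg a).eq_or_lt with h0 | hpos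
    · have := hbound 0
      rw [← h0] at this hlt
      simp at this
      rw [this] at hlt
      simp at hlt
    · have h1 : 1 < ‖ρ.π a‖ / iNorm a := (one_lt_div hpos).2 hlt
      obtain ⟨n, hn⟩ := pow_unbounded_of_one_lt (max C 0) h1
      have h2 : (‖ρ.π a‖ / iNorm a) ^ n ≤ (‖ρ.π a‖ / iNorm a) ^ 2 ^ n :=
        pow_le_pow_right₀ h1.le Nat.lt_two_pow_self.le
      have h3 := hbound n
      rw [← div_le_iff₀ (by positivity), ← div_pow] at h3
      linarith
  have h1 : ‖ρ.π a‖ = ‖ρ.π f‖ * ‖ρ.π f‖ := by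
    rw [ha, map_mul, map_star, CStarRing.norm_star_mul_self]
  have h2 : iNorm a ≤ iNorm f * iNorm f := by
    refine (iNorm_mul_le _ _).trans (le_of_eq ?_)
    rw [iNorm_star]
  have h3 := norm_nonneg (ρ.π f)
  have h4 := iNorm_nonneg f
  by_contra! hlt
  nlinarith

variable (G)

/-- The full norm of `C_c(G)`: the supremum of `‖π f‖` over all `I`-norm-bounded
`*`-representations `π`. -/
noncomputable def fullNorm : CStarSeminorm (ConvAlgebra G) :=
  CStarSeminorm.ofFamily (fun ρ : BoundedRep G => ρ.π) fun f =>
    ⟨iNorm f, by rintro _ ⟨ρ, rfl⟩; exact ρ.norm_le f⟩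

/-- The reduced norm of `C_c(G)`: the supremum of `‖Ind_u f‖` over all units `u`. -/
noncomputable def reducedNorm : CStarSeminorm (ConvAlgebra G) :=
  CStarSeminorm.ofFamily (fun u : unitSpace G => regularRep (u : G)) fun f =>
    ⟨iNorm f, by rintro _ ⟨u, rfl⟩; exact norm_indOp_le (u : G) f⟩

end ConvAlgebra

section CStar

variable (G : Type*) [TopologicalSpace G] [EtaleGroupoid G] [T2Space G]

/-- The full C*-algebra `C*(G)`, the completion of `C_c(G)` in the full norm. -/
abbrev FullCStar : Type _ := (ConvAlgebra.fullNorm G).Compl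

/-- The reduced C*-algebra `C*_r(G)`, the completion of `C_c(G)` in the reduced norm. -/
abbrev ReducedCStar : Type _ := (ConvAlgebra.reducedNorm G).Compl

/-- `C*(G) = C*_r(G)`: the identity of `C_c(G)` extends to an isomorphism of C*-algebras. -/
def FullEqReduced : Prop :=
  ∃ Φ : FullCStar G ≃⋆ₐ[ℂ] ReducedCStar G, ∀ f : ConvAlgebra G,
    Φ ((ConvAlgebra.fullNorm G).toCompl f) = (ConvAlgebra.reducedNorm G).toCompl f

end CStar

namespace CStarSeminorm

open UniformSpace

variable {A : Type*} [NonUnitalRing A] [StarRing A] [Module ℂ A]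

/-! Suppose `C*(G)` is simple. A nonzero `I`-norm-bounded representation extends to `C*(G)`, and the
kernel of the extension is a proper closed ideal, hence zero. So the representation is isometric for
the full norm (`BoundedRep.norm_eq_fullNorm`) and faithful on `C_c(G)` (`BoundedRep.eq_zero`). Each
condition follows from a suitable choice of representation. One regular representation `Ind_v` is
nonzero and dominated by the reduced norm, so the two norms agree. If `U` were a nonempty proper
open invariant set of units, `Ind_v` with `v` outside `U` would kill the functions supported in `U`;
so `G` is minimal. Finally, on `ℓ²(G⁽⁰⁾)` an arrow acts by moving its source to its range, so an
isotropy arrow acts on the basis vector at its source just as the unit does. An open set of isotropy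
containing a non-unit would therefore give a nonzero function in the kernel
(`subset_unitSpace_of_isSimple`). Thus `G` is effective, and since it is second countable a Baire
category argument makes it topologically principal.

Conversely, equality of the norms reduces the claim to `C*_r(G)`. A nonzero closed ideal contains
some `b = a* a` whose conditional expectation is nonzero at a unit. Approximate `b` by `f` in
`C_c(G)`, move to a nearby unit with trivial isotropy, and cut `f` down on both sides to a small
neighbourhood: only the part of `f` on the unit space survives. After rescaling, this part is close
to the ideal and acts as an identity on a bump function `e`, which forces `e` into the ideal
(`exists_unit_mem_ideal`). The units at which some function of the ideal supported on the unit space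
is nonzero form an open set, invariant under conjugation by functions on bisections. By minimality
it is the whole unit space, and then every element of `C_c(G)` factors through the ideal
(`ideal_eq_top`). -/

lemma eq_of_apply_eq {p q : CStarSeminorm A} (h : ∀ a, p.toSeminorm a = q.toSeminorm a) :
    p = q := by
  cases p
  cases q
  congr
  exact Seminorm.ext h

/-! ### Representations of the completion and the use of simplicity. -/

section Extend

variable (p : CStarSeminorm A) {B : Type*} [NonUnitalCStarAlgebra B] (φ : A →⋆ₙₐ[ℂ] B)

lemma uniformContinuous_of_norm_le (hφ : ∀ a, ‖φ a‖ ≤ p.toSeminorm a) :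
    UniformContinuous fun a : p.Carrier => φ (a : A) := by
  let ψ : p.Carrier →+ B :=
    { toFun := fun a => φ (a : A), map_zero' := map_zero φ, map_add' := map_add φ }
  exact AddMonoidHomClass.uniformContinuous_of_bound ψ 1 fun a => by
    rw [one_mul]; exact hφ a

/-- The underlying function of `CStarSeminorm.extend`. -/
noncomputable def extendFun (p : CStarSeminorm A) (φ : A →⋆ₙₐ[ℂ] B) : p.Compl → B :=
  Completion.extension fun a : p.Carrier => φ (a : A)

lemma continuous_extendFun : Continuous (extendFun p φ) :=
  Completion.continuous_extension

lemma extendFun_toCompl (hφ : ∀ a, ‖φ a‖ ≤ p.toSeminorm a) (a : A) :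
    extendFun p φ (p.toCompl a) = φ a :=
  Completion.extension_coe (uniformContinuous_of_norm_le p φ hφ) a

/-- The extension to the completion of a `*`-homomorphism into a C*-algebra dominated by the
C*-seminorm `p`. -/
noncomputable def extend (hφ : ∀ a, ‖φ a‖ ≤ p.toSeminorm a) :
    p.Compl →⋆ₙₐ[ℂ] B where
  toFun := extendFun p φ
  map_smul' c := by
    have hc := continuous_extendFun p φ
    refine ind₁ p (isClosed_eq (hc.comp (continuous_const_smul c)) (hc.const_smul _)) fun a => ?_
    rw [← toCompl_smul, extendFun_toCompl p φ hφ, extendFun_toCompl p φ hφ, map_smul]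
    rfl
  map_zero' := by
    change extendFun p φ (p.toCompl 0) = 0
    rw [extendFun_toCompl p φ hφ, map_zero]
  map_add' := by
    have hc := continuous_extendFun p φ
    refine ind₂ p (isClosed_eq (hc.comp continuous_add)
      ((hc.comp continuous_fst).add (hc.comp continuous_snd))) fun a b => ?_
    rw [← toCompl_add]
    simp only [extendFun_toCompl p φ hφ, map_add]
  map_mul' := by
    have hc := continuous_extendFun p φ
    refine ind₂ p (isClosed_eq (hc.comp continuous_mul)
      ((hc.comp continuous_fst).mul (hc.comp continuous_snd))) fun a b => ?_
    rw [← toCompl_mul]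
    simp only [extendFun_toCompl p φ hφ, map_mul]
  map_star' := by
    have hc := continuous_extendFun p φ
    refine ind₁ p (isClosed_eq (hc.comp continuous_star) hc.star) fun a => ?_
    rw [← toCompl_star]
    simp only [extendFun_toCompl p φ hφ, map_star]

@[simp] lemma extend_toCompl (hφ : ∀ a, ‖φ a‖ ≤ p.toSeminorm a) (a : A) :
    extend p φ hφ (p.toCompl a) = φ a :=
  extendFun_toCompl p φ hφ a

lemma continuous_extend (hφ : ∀ a, ‖φ a‖ ≤ p.toSeminorm a) :
    Continuous (extend p φ hφ) := continuous_extendFun p φ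

variable [IsScalarTower ℂ A A] [SMulCommClass ℂ A A] [StarModule ℂ A]

lemma norm_extend_le (hφ : ∀ a, ‖φ a‖ ≤ p.toSeminorm a) (x : p.Compl) : ‖extend p φ hφ x‖ ≤ ‖x‖ :=
  NonUnitalStarAlgHom.norm_apply_le _ x

/-- A nonzero representation of a simple completion is isometric. -/
lemma norm_eq_of_isSimple (hφ : ∀ a, ‖φ a‖ ≤ p.toSeminorm a)
    (hs : IsSimpleCStarAlgebra p.Compl) (hne : ∃ a, φ a ≠ 0) (a : A) :
    ‖φ a‖ = p.toSeminorm a := by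
  let Λ := extend p φ hφ
  let I : Submodule ℂ p.Compl :=
    { carrier := {x | Λ x = 0}
      zero_mem' := map_zero Λ
      add_mem' := fun {x y} hx hy => by
        change Λ (x + y) = 0
        rw [map_add, show Λ x = 0 from hx, show Λ y = 0 from hy, add_zero]
      smul_mem' := fun c x hx => by
        change Λ (c • x) = 0
        rw [map_smul, show Λ x = 0 from hx, smul_zero] }
  have hI : ∀ x, x ∈ I ↔ Λ x = 0 := fun x => Iff.rfl
  have hclosed : IsClosed (I : Set p.Compl) :=
    isClosed_eq (continuous_extend p φ hφ) continuous_const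
  -- The kernel of `Λ` is a closed ideal. It is not everything because `φ` is nonzero, and an
  -- injective `*`-homomorphism of C*-algebras is isometric.
  have hinj : Function.Injective Λ := by
    rcases hs.2 I hclosed (fun a x hx => by
      rw [hI] at hx
      simp only [hI, map_mul, hx, mul_zero, zero_mul, and_self]) with h | h
    · refine (injective_iff_map_eq_zero Λ).2 fun x hx => ?_
      have : x ∈ I := hx
      rwa [h, Submodule.mem_bot] at this
    · obtain ⟨a, ha⟩ := hne
      have : p.toCompl a ∈ I := h ▸ Submodule.mem_top
      rw [hI] at this
      exact absurd (by rw [← this, extend_toCompl]) ha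
  rw [← norm_toCompl, ← NonUnitalStarAlgHom.norm_map Λ hinj, extend_toCompl]

end Extend

end CStarSeminorm

/-! ### Membership in a closed ideal by approximation. -/

/-- If a closed ideal contains an element at distance less than `1` from `k`, it contains every `e`
with `e * k = e`. -/
lemma Submodule.mem_of_norm_sub_lt_one {A : Type*} [NonUnitalCStarAlgebra A] {I : Submodule ℂ A}
    (hc : IsClosed (I : Set A)) (hI : ∀ a : A, ∀ x ∈ I, a * x ∈ I ∧ x * a ∈ I) {g k e : A}
    (hg : g ∈ I) (hgk : ‖k - g‖ < 1) (he : e * k = e) : e ∈ I := by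
  -- `T n` is `e (k - g)ⁿ`, written as an iteration because the algebra need not have a unit. Modulo
  -- the ideal `k - g` acts like `k`, so `T n` stays congruent to `e`, while `‖k - g‖ < 1` makes it
  -- tend to `0`.
  let T : ℕ → A := fun n => (fun y => y * (k - g))^[n] e
  have hT : ∀ n, T (n + 1) = T n * (k - g) := fun n => Function.iterate_succ_apply' _ n e
  have hTk : ∀ n, e - T n ∈ I := by
    intro n
    induction n with
    | zero => simp [T]
    | succ n ih =>
      have h1 : e - T (n + 1) = (e - T n) * (k - g) + e * g := by
        rw [hT, sub_mul, show e * (k - g) = e - e * g by rw [mul_sub, he]]; abel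
      rw [h1]
      exact I.add_mem (hI _ _ ih).2 (hI _ _ hg).1
  have hTn : ∀ n, ‖T n‖ ≤ ‖e‖ * ‖k - g‖ ^ n := by
    intro n
    induction n with
    | zero => simp [T]
    | succ n ih =>
      rw [hT, pow_succ, ← mul_assoc]
      exact (norm_mul_le _ _).trans (mul_le_mul_of_nonneg_right ih (norm_nonneg _))
  have hT0 : Filter.Tendsto T Filter.atTop (nhds 0) := by
    refine squeeze_zero_norm hTn ?_
    simpa using (tendsto_pow_atTop_nhds_zero_of_lt_one (norm_nonneg _) hgk).const_mul ‖e‖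
  have := (tendsto_const_nhds (x := e)).sub hT0
  rw [sub_zero] at this
  exact hc.mem_of_tendsto this (Filter.Eventually.of_forall hTk)

/-! ### The unit space, bump functions and comparison of norms. -/

namespace ConvAlgebra

open ArrowGroupoid Topology

universe u

variable {G : Type u} [TopologicalSpace G] [EtaleGroupoid G] [T2Space G]

set_option linter.unusedSectionVars false

lemma isClosed_unitSpace : IsClosed (unitSpace G) := by
  have : unitSpace G = {γ : G | rng γ = γ} :=
    Set.ext fun γ => ⟨rng_unit, fun h => h ▸ rng_mem γ⟩
  rw [this]
  exact isClosed_eq continuous_rng continuous_id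

lemma inv_unit {v : G} (hv : v ∈ unitSpace G) : v⁻¹ = v := by
  conv_lhs => rw [← src_unit hv]
  rw [inv_src, src_unit hv]

lemma rng_mul_right {α γ : G} (h : rng α = rng γ) : rng (α⁻¹ * γ) = src α := by
  rw [rng_mul _ _ ((src_inv α).trans h), rng_inv]

/-- Left multiplication by a function supported on the unit space. -/
lemma unit_mul_apply {h : ConvAlgebra G} (hh : ∀ γ ∉ unitSpace G, h γ = 0) (f : ConvAlgebra G)
    (γ : G) : (h * f) γ = h (rng γ) * f γ := by
  rw [mul_apply, tsum_eq_single ⟨rng γ, rng_rng γ⟩]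
  · rw [inv_unit (rng_mem γ), rng_mul_self]
  · intro α hα
    rw [hh, zero_mul]
    intro hu
    exact hα (Subtype.ext ((rng_unit hu).symm.trans α.2))

/-- Right multiplication by a function supported on the unit space. -/
lemma mul_unit_apply {h : ConvAlgebra G} (hh : ∀ γ ∉ unitSpace G, h γ = 0) (f : ConvAlgebra G)
    (γ : G) : (f * h) γ = f γ * h (src γ) := by
  rw [mul_apply, tsum_eq_single ⟨γ, rfl⟩]
  · rw [inv_mul]
  · intro α hα
    rw [hh, mul_zero]
    intro hu
    refine hα (Subtype.ext ?_)
    have h1 := inv_mul_cancel_left (a := (α : G)) (b := γ) α.2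
    rw [← rng_unit hu, rng_mul_right α.2, self_mul_src] at h1
    exact h1

/-- Bump functions. -/
lemma exists_bump [LocallyCompactSpace G] {K U : Set G} (hK : IsCompact K) (hU : IsOpen U)
    (hKU : K ⊆ U) :
    ∃ f : ConvAlgebra G, (∀ γ ∈ K, f γ = 1) ∧ tsupport f ⊆ U ∧ (∀ γ ∉ U, f γ = 0) ∧
      ∀ γ, ‖f γ‖ ≤ 1 := by
  obtain ⟨f, h1, h2, h3, h4⟩ := exists_continuousMap_one_of_isCompact_subset_isOpen hK hU hKU
  have hc : HasCompactSupport fun γ => (f γ : ℂ) :=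
    HasCompactSupport.intro h2 fun γ hγ => by
      rw [image_eq_zero_of_notMem_tsupport hγ, Complex.ofReal_zero]
  have hs : tsupport (fun γ => (f γ : ℂ)) ⊆ tsupport f := by
    refine closure_mono fun γ hγ h0 => hγ ?_
    simp only [h0, Complex.ofReal_zero]
  refine ⟨mk' (fun γ => (f γ : ℂ)) (Complex.continuous_ofReal.comp f.continuous) hc,
    fun γ hγ => ?_, hs.trans h3, fun γ hγ => ?_, fun γ => ?_⟩
  · rw [mk'_apply, h1 hγ]; simp
  · exact notMem fun h => hγ (h3 (hs h))
  · rw [mk'_apply, Complex.norm_real, Real.norm_of_nonneg (h4 γ).1]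
    exact (h4 γ).2

lemma exists_bump_at [LocallyCompactSpace G] {γ : G} {U : Set G} (hU : IsOpen U) (h : γ ∈ U) :
    ∃ f : ConvAlgebra G, f γ = 1 ∧ tsupport f ⊆ U ∧ (∀ γ ∉ U, f γ = 0) ∧ ∀ γ, ‖f γ‖ ≤ 1 := by
  obtain ⟨f, h1, h2⟩ := exists_bump isCompact_singleton hU (Set.singleton_subset_iff.2 h)
  exact ⟨f, h1 γ rfl, h2⟩

/-- `f γ` is the matrix coefficient of `Ind` at `src γ` between the basis vectors of the unit `src
γ` and of `γ`. Hence the reduced and full norms dominate the sup norm and are norms on `C_c(G)`. -/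
lemma norm_apply_le_norm_indOp (f : ConvAlgebra G) (γ : G) : ‖f γ‖ ≤ ‖indOp (src γ) f‖ := by
  classical
  rw [apply_eq_ker, ← indOp_single]
  refine (lp.norm_apply_le_norm (by simp) _ _).trans ?_
  refine (ContinuousLinearMap.le_opNorm _ _).trans (le_of_eq ?_)
  rw [lp.norm_single (by simp), norm_one, mul_one]

lemma norm_indOp_le_reducedNorm (f : ConvAlgebra G) {v : G} (hv : v ∈ unitSpace G) :
    ‖indOp v f‖ ≤ (reducedNorm G).toSeminorm f :=
  le_ciSup (f := fun v : unitSpace G => ‖indOp (v : G) f‖)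
    ⟨iNorm f, by rintro _ ⟨v, rfl⟩; exact norm_indOp_le (v : G) f⟩ ⟨v, hv⟩

lemma norm_apply_le_reducedNorm (f : ConvAlgebra G) (γ : G) :
    ‖f γ‖ ≤ (reducedNorm G).toSeminorm f :=
  (norm_apply_le_norm_indOp f γ).trans (norm_indOp_le_reducedNorm f (src_mem γ))

lemma reducedNorm_le {f : ConvAlgebra G} {C : ℝ} (hC : 0 ≤ C)
    (h : ∀ v ∈ unitSpace G, ‖indOp v f‖ ≤ C) : (reducedNorm G).toSeminorm f ≤ C :=
  Real.iSup_le (fun v => h v v.2) hC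

lemma BoundedRep.norm_le_fullNorm (ρ : BoundedRep G) (f : ConvAlgebra G) :
    ‖ρ.π f‖ ≤ (fullNorm G).toSeminorm f :=
  le_ciSup (f := fun ρ : BoundedRep G => ‖ρ.π f‖)
    ⟨iNorm f, by rintro _ ⟨ρ, rfl⟩; exact ρ.norm_le f⟩ ρ

/-- The regular representation as a bounded representation. -/
noncomputable def regularBoundedRep (v : G) : BoundedRep G where
  H := L2Fiber v
  π := regularRep v
  bounded := ⟨1, fun f => (norm_indOp_le v f).trans_eq (one_mul _).symm⟩

lemma norm_indOp_le_fullNorm (f : ConvAlgebra G) (v : G) :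
    ‖indOp v f‖ ≤ (fullNorm G).toSeminorm f :=
  (regularBoundedRep v).norm_le_fullNorm f

lemma reducedNorm_le_fullNorm (f : ConvAlgebra G) :
    (reducedNorm G).toSeminorm f ≤ (fullNorm G).toSeminorm f :=
  reducedNorm_le (apply_nonneg _ _) fun v _ => norm_indOp_le_fullNorm f v

lemma norm_apply_le_fullNorm (f : ConvAlgebra G) (γ : G) :
    ‖f γ‖ ≤ (fullNorm G).toSeminorm f :=
  (norm_apply_le_reducedNorm f γ).trans (reducedNorm_le_fullNorm f)

/-! ### Consequences of simplicity: equality of the norms and minimality. -/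

/-- Nonzero bounded representations of `C_c(G)` preserve the full norm if `C*(G)` is simple. -/
lemma BoundedRep.norm_eq_fullNorm (hs : IsSimpleCStarAlgebra (FullCStar G)) (ρ : BoundedRep G)
    (hne : ∃ f, ρ.π f ≠ 0) (f : ConvAlgebra G) : ‖ρ.π f‖ = (fullNorm G).toSeminorm f :=
  CStarSeminorm.norm_eq_of_isSimple (fullNorm G) ρ.π ρ.norm_le_fullNorm hs hne f

/-- The full norm dominates pointwise values, so an isometric representation has no kernel on
`C_c(G)`. Both minimality and effectiveness are proved by exhibiting a function that would violate
this. -/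
lemma BoundedRep.eq_zero (hs : IsSimpleCStarAlgebra (FullCStar G)) (ρ : BoundedRep G)
    (hne : ∃ f, ρ.π f ≠ 0) {f : ConvAlgebra G} (hf : ρ.π f = 0) : f = 0 := by
  refine ext fun γ => ?_
  have h := norm_apply_le_fullNorm f γ
  rw [← ρ.norm_eq_fullNorm hs hne, hf, norm_zero] at h
  exact norm_le_zero_iff.1 h

/-- A `*`-isomorphism of C*-algebras is isometric, so it can only match the images of `C_c(G)` if
the norms agree. Equal seminorms have the same completion. -/
lemma fullEqReduced_iff :
    FullEqReduced G ↔ fullNorm G = reducedNorm G := by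
  constructor
  · rintro ⟨Φ, hΦ⟩
    refine CStarSeminorm.eq_of_apply_eq fun f => ?_
    rw [← CStarSeminorm.norm_toCompl, ← CStarSeminorm.norm_toCompl, ← hΦ, StarAlgEquiv.norm_map]
  · intro h
    -- The seminorm is generalised to a variable so that the equality can be eliminated, although it
    -- occurs in the type of the completion.
    have : ∀ q : CStarSeminorm (ConvAlgebra G), fullNorm G = q →
        ∃ Φ : (fullNorm G).Compl ≃⋆ₐ[ℂ] q.Compl, ∀ f, Φ ((fullNorm G).toCompl f) = q.toCompl f := by
      rintro _ rfl
      exact ⟨StarAlgEquiv.refl ℂ _, fun _ => rfl⟩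
    exact this _ h

lemma regularBoundedRep_ne_zero [LocallyCompactSpace G] {v : G} (hv : v ∈ unitSpace G) :
    ∃ f, (regularBoundedRep v).π f ≠ 0 := by
  obtain ⟨f, hf, -⟩ := exists_bump_at (γ := v) isOpen_univ trivial
  refine ⟨f, fun h => ?_⟩
  have h1 := norm_apply_le_norm_indOp f v
  rw [src_unit hv, show indOp v f = 0 from h, norm_zero, hf, norm_one] at h1
  exact absurd h1 (by norm_num)

/-- If `C*(G)` is simple, it agrees with the reduced C*-algebra. -/
lemma fullNorm_eq_reducedNorm [LocallyCompactSpace G] [Nonempty G]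
    (hs : IsSimpleCStarAlgebra (FullCStar G)) : fullNorm G = reducedNorm G := by
  obtain ⟨γ⟩ := ‹Nonempty G›
  refine CStarSeminorm.eq_of_apply_eq fun f => le_antisymm ?_ (reducedNorm_le_fullNorm f)
  -- A single regular representation already computes the full norm, and the reduced norm lies above
  -- it.
  rw [← (regularBoundedRep (src γ)).norm_eq_fullNorm hs
    (regularBoundedRep_ne_zero (src_mem γ)) f]
  exact norm_indOp_le_reducedNorm f (src_mem γ)

/-- If `C*(G)` is simple, `G` is minimal. -/
lemma isMinimal_of_isSimple [LocallyCompactSpace G]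
    (hs : IsSimpleCStarAlgebra (FullCStar G)) : IsMinimal G := by
  intro U hU hinv
  by_contra! hne
  obtain ⟨⟨x, hx⟩, hxU⟩ := hne.1
  obtain ⟨v, hv⟩ := (Set.ne_univ_iff_exists_notMem U).1 hne.2
  have hU' : IsOpen (Subtype.val '' U) := (isOpen_unitSpace G).isOpenMap_subtype_val U hU
  obtain ⟨f, hf, -, hf0, -⟩ := exists_bump_at hU' ⟨⟨x, hx⟩, hxU, rfl⟩
  -- A nonzero kernel entry would make `γ β⁻¹` a unit in `U`, namely the source of `β⁻¹`. Invariance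
  -- would then put the range of `β⁻¹`, which is `v`, into `U`.
  have hz : indOp (v : G) f = 0 := by
    refine ContinuousLinearMap.ext fun ξ => lp.ext <| funext fun γ => ?_
    change ∑' β, ker f v γ β * ξ β = 0
    refine (tsum_congr fun β => ?_).trans tsum_zero
    rw [ker, hf0, zero_mul]
    rintro ⟨w, hw, hwe⟩
    have h1 : s (β : G)⁻¹ = w := Subtype.ext <| by
      change src (β : G)⁻¹ = w
      rw [← src_unit w.2, hwe, src_mul _ _ (comp_aux γ β)]
    have h2 : r (β : G)⁻¹ = v := Subtype.ext ((rng_inv _).trans β.2)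
    exact hv (h2 ▸ hinv _ (h1 ▸ hw))
  have := (regularBoundedRep (v : G)).eq_zero hs (regularBoundedRep_ne_zero v.2) hz
  rw [this, zero_apply] at hf
  exact zero_ne_one hf

/-! ### The representation on `ℓ²(G⁽⁰⁾)` -/

/-- Cauchy–Schwarz, splitting `|a i| |x i|` as `|a i|^(1/2)` times `|a i|^(1/2) |x i|`. This is the
row estimate in the Schur test. -/
lemma enorm_tsum_mul_sq_le {ι : Type*} {a : ι → ℂ} (ha : a.support.Finite) (x : ι → ℂ) :
    ‖∑' i, a i * x i‖ₑ ^ 2 ≤ (∑' i, ‖a i‖ₑ) * ∑' i, ‖a i‖ₑ * ‖x i‖ₑ ^ 2 := by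
  classical
  have hz : ∀ i ∉ ha.toFinset, a i = 0 := fun i hi => by simpa using hi
  rw [tsum_eq_sum (s := ha.toFinset) fun i hi => by rw [hz i hi, zero_mul],
    tsum_eq_sum (s := ha.toFinset) fun i hi => by rw [hz i hi, enorm_zero],
    tsum_eq_sum (s := ha.toFinset) fun i hi => by rw [hz i hi, enorm_zero, zero_mul]]
  have h : ‖∑ i ∈ ha.toFinset, a i * x i‖₊ ^ 2
      ≤ (∑ i ∈ ha.toFinset, ‖a i‖₊) * ∑ i ∈ ha.toFinset, ‖a i‖₊ * ‖x i‖₊ ^ 2 := by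
    calc ‖∑ i ∈ ha.toFinset, a i * x i‖₊ ^ 2
        ≤ (∑ i ∈ ha.toFinset, ‖a i‖₊ * ‖x i‖₊) ^ 2 := by
          gcongr
          exact (nnnorm_sum_le _ _).trans (Finset.sum_le_sum fun i _ => (nnnorm_mul _ _).le)
      _ ≤ _ := Finset.sum_sq_le_sum_mul_sum_of_sq_le_mul _ (fun _ _ => by positivity)
            (fun _ _ => by positivity) fun _ _ => le_of_eq (by ring)
  simp only [enorm_eq_nnnorm]
  exact_mod_cast h

variable (G) in
/-- The Hilbert space `ℓ²(G⁽⁰⁾)`. -/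
abbrev L2Units : Type u := lp (fun _ : unitSpace G => ℂ) 2

/-- The action of `C_c(G)` on functions on the unit space:
`(f · x)(y) = ∑_{r(α) = y} f(α) x(s(α))`. -/
noncomputable def orbitFun (f : ConvAlgebra G) (x : unitSpace G → ℂ) (y : unitSpace G) : ℂ :=
  ∑' α : RngFiber (y : G), f α * x (s (α : G))

lemma summable_orbitFun (f : ConvAlgebra G) (x : unitSpace G → ℂ) (y : unitSpace G) :
    Summable fun α : RngFiber (y : G) => f α * x (s (α : G)) :=
  summable_of_hasFiniteSupport
    ((finite_rngFiber f y).subset (Function.support_mul_subset_left _ _))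

/-- Pulled back along `r` to a source fibre, the action on functions of units becomes the kernel
action. Multiplicativity is thereby inherited from `tsum_ker_assoc`. -/
lemma orbitFun_r (f : ConvAlgebra G) (x : unitSpace G → ℂ) {v : G} (γ : SrcFiber v) :
    orbitFun f x (r (γ : G)) = ∑' β : SrcFiber v, ker f v γ β * x (r (β : G)) := by
  change ∑' α : RngFiber (rng (γ : G)), f α * x (s (α : G)) = _
  rw [← (rngEquiv γ).tsum_eq]
  refine tsum_congr fun α => ?_
  have h1 : ker f v γ (rngEquiv γ α)
      = f ((rngEquiv γ).symm (rngEquiv γ α) : RngFiber (rng (γ : G))) := rfl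
  have h2 : r ((rngEquiv γ α : SrcFiber v) : G) = s (α : G) :=
    Subtype.ext (rng_mul_right α.2)
  rw [h1, Equiv.symm_apply_apply, h2]

lemma orbitFun_mul (f g : ConvAlgebra G) (x : unitSpace G → ℂ) :
    orbitFun (f * g) x = orbitFun f (orbitFun g x) := by
  funext y
  obtain ⟨γ, hγ⟩ : ∃ γ : SrcFiber (y : G), r (γ : G) = y :=
    ⟨⟨y, src_unit y.2⟩, Subtype.ext (rng_unit y.2)⟩
  rw [← hγ, orbitFun_r, orbitFun_r]
  simp_rw [ker_mul, orbitFun_r]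
  exact tsum_ker_assoc f g _ _

/-- Both sides are the sum over all arrows, grouped by range and by source. In the Schur test this
plays the role of exchanging rows and columns. -/
lemma tsum_rngFiber_eq_tsum_srcFiber (F : G → ENNReal) :
    ∑' y : unitSpace G, ∑' α : RngFiber (y : G), F α
      = ∑' y : unitSpace G, ∑' α : SrcFiber (y : G), F α := by
  have h1 := ENNReal.tsum_fiberwise F (r : G → unitSpace G)
  have h2 := ENNReal.tsum_fiberwise F (s : G → unitSpace G)
  rw [← h2] at h1
  convert h1 using 3 with y y
  · exact ((Equiv.subtypeEquivRight fun γ => by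
      rw [Set.mem_preimage, Set.mem_singleton_iff, Subtype.ext_iff]; rfl).tsum_eq
        fun α : (r : G → unitSpace G) ⁻¹' {y} => F α)
  · exact ((Equiv.subtypeEquivRight fun γ => by
      rw [Set.mem_preimage, Set.mem_singleton_iff, Subtype.ext_iff]; rfl).tsum_eq
        fun α : (s : G → unitSpace G) ⁻¹' {y} => F α)

/-- The Schur test: row sums are sums over range fibres, column sums are sums over source fibres,
and the `I`-norm bounds both. -/
lemma tsum_enorm_orbitFun_sq_le (f : ConvAlgebra G) (x : unitSpace G → ℂ) :
    ∑' y, ‖orbitFun f x y‖ₑ ^ 2 ≤ ENNReal.ofReal (iNorm f) ^ 2 * ∑' y, ‖x y‖ₑ ^ 2 := by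
  have hrow : ∀ y : unitSpace G, ∑' α : RngFiber (y : G), ‖f α‖ₑ ≤ ENNReal.ofReal (iNorm f) := by
    intro y
    have := enorm_src_le (star f) y.2
    rw [iNorm_star, ← (invEquiv (y : G)).symm.tsum_eq] at this
    refine le_trans (le_of_eq (tsum_congr fun α => ?_)) this
    change _ = ‖star f (α : G)⁻¹‖ₑ
    rw [star_apply, inv_inv_self, ← ofReal_norm, ← ofReal_norm, norm_star]
  calc ∑' y, ‖orbitFun f x y‖ₑ ^ 2
      ≤ ∑' y : unitSpace G, ENNReal.ofReal (iNorm f) *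
          ∑' α : RngFiber (y : G), ‖f α‖ₑ * ‖x (s (α : G))‖ₑ ^ 2 :=
        ENNReal.tsum_le_tsum fun y => (enorm_tsum_mul_sq_le (finite_rngFiber f y) _).trans
          (mul_le_mul_left (hrow y) _)
    _ = ENNReal.ofReal (iNorm f) * ∑' y : unitSpace G,
          ∑' α : SrcFiber (y : G), ‖f α‖ₑ * ‖x (s (α : G))‖ₑ ^ 2 := by
        rw [ENNReal.tsum_mul_left,
          tsum_rngFiber_eq_tsum_srcFiber fun α => ‖f α‖ₑ * ‖x (s α)‖ₑ ^ 2]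
    _ = ENNReal.ofReal (iNorm f) * ∑' y : unitSpace G,
          (∑' α : SrcFiber (y : G), ‖f α‖ₑ) * ‖x y‖ₑ ^ 2 := by
        congr 1
        refine tsum_congr fun y => ?_
        rw [← ENNReal.tsum_mul_right]
        refine tsum_congr fun α => ?_
        rw [show s (α : G) = y from Subtype.ext α.2]
    _ ≤ ENNReal.ofReal (iNorm f) * ∑' y : unitSpace G,
          ENNReal.ofReal (iNorm f) * ‖x y‖ₑ ^ 2 :=
        mul_le_mul_right (ENNReal.tsum_le_tsum fun y =>
          mul_le_mul_left (enorm_src_le f y.2) _) _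
    _ = _ := by rw [ENNReal.tsum_mul_left]; ring

lemma memℓp_orbitFun (f : ConvAlgebra G) (x : L2Units G) : Memℓp (orbitFun f x) 2 := by
  apply memℓp_of_tsum
  refine ne_top_of_le_ne_top ?_ (tsum_enorm_orbitFun_sq_le f x)
  rw [lp_tsum_enorm]
  finiteness

/-- The operator on `ℓ²(G⁽⁰⁾)` given by `f ∈ C_c(G)`. -/
noncomputable def orbitOp (f : ConvAlgebra G) : L2Units G →L[ℂ] L2Units G :=
  LinearMap.mkContinuous
    { toFun := fun x => ⟨orbitFun f x, memℓp_orbitFun f x⟩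
      map_add' := fun x y => lp.ext <| funext fun z => by
        change ∑' α : RngFiber (z : G), f α * (x (s (α : G)) + y (s (α : G)))
          = orbitFun f x z + orbitFun f y z
        rw [orbitFun, orbitFun, ← (summable_orbitFun f x z).tsum_add (summable_orbitFun f y z)]
        exact tsum_congr fun α => mul_add _ _ _
      map_smul' := fun c x => lp.ext <| funext fun z => by
        change ∑' α : RngFiber (z : G), f α * (c * x (s (α : G))) = c * orbitFun f x z
        rw [orbitFun, ← tsum_mul_left]
        exact tsum_congr fun α => mul_left_comm _ _ _ }
    (iNorm f) fun x => by
      have h := tsum_enorm_orbitFun_sq_le f x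
      have h2 := lp_tsum_enorm (⟨orbitFun f x, memℓp_orbitFun f x⟩ : L2Units G)
      rw [lp_tsum_enorm] at h
      have h3 := h2.symm.trans_le h
      rw [← ENNReal.ofReal_pow (iNorm_nonneg f), ← ENNReal.ofReal_mul (by positivity),
        ← mul_pow, ENNReal.ofReal_le_ofReal_iff (by positivity)] at h3
      exact (sq_le_sq₀ (norm_nonneg _) (mul_nonneg (iNorm_nonneg f) (norm_nonneg _))).1 h3

lemma orbitOp_apply (f : ConvAlgebra G) (x : L2Units G) (y : unitSpace G) :
    orbitOp f x y = orbitFun f x y := rfl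

lemma norm_orbitOp_le (f : ConvAlgebra G) : ‖orbitOp f‖ ≤ iNorm f :=
  LinearMap.mkContinuous_norm_le _ (iNorm_nonneg f) _

open Classical in
-- The matrix entry at `(y, x)` adds up `f` over the arrows from `x` to `y`. The sum is indexed by
-- all of `G` so that inversion, which swaps `x` and `y`, is a plain reindexing in
-- `orbitOp_single_star`.
lemma orbitOp_single (f : ConvAlgebra G) (x y : unitSpace G) :
    orbitOp f (lp.single 2 x (1 : ℂ)) y
      = ∑' α : G, if rng α = y ∧ src α = x then f α else 0 := by
  rw [orbitOp_apply, orbitFun]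
  refine (tsum_subtype {α : G | rng α = y}
    fun α => f α * (lp.single 2 x (1 : ℂ) : L2Units G) (s α)).trans (tsum_congr fun α => ?_)
  by_cases h1 : rng α = y
  · rw [Set.indicator_of_mem (show α ∈ {α : G | rng α = y} from h1)]
    by_cases h2 : src α = x
    · obtain rfl : s α = x := Subtype.ext h2
      rw [if_pos ⟨h1, h2⟩]
      simp
    · have h3 : s α ≠ x := fun h => h2 (congrArg Subtype.val h)
      rw [if_neg fun h => h2 h.2]
      simp [h3]
  · rw [Set.indicator_of_notMem (show α ∉ {α : G | rng α = y} from h1), if_neg fun h => h1 h.1]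

open Classical in
lemma orbitOp_single_star (f : ConvAlgebra G) (x y : unitSpace G) :
    orbitOp (star f) (lp.single 2 x (1 : ℂ)) y = star (orbitOp f (lp.single 2 y (1 : ℂ)) x) := by
  let inv : G ≃ G := ⟨fun γ => γ⁻¹, fun γ => γ⁻¹, inv_inv_self, inv_inv_self⟩
  rw [orbitOp_single, orbitOp_single, ← inv.tsum_eq, tsum_star]
  refine tsum_congr fun α => ?_
  change (if rng α⁻¹ = y ∧ src α⁻¹ = x then star f α⁻¹ else 0) = _
  rw [rng_inv, src_inv, star_apply, inv_inv_self]
  by_cases h : rng α = x ∧ src α = y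
  · rw [if_pos h, if_pos h.symm]
  · rw [if_neg h, if_neg fun h' => h h'.symm, star_zero]

lemma orbitOp_star (f : ConvAlgebra G) : orbitOp (star f) = star (orbitOp f) := by
  classical
  refine lp.ext_continuousLinearMap (by simp) fun x => ContinuousLinearMap.ext_ring ?_
  refine lp.ext <| funext fun y => ?_
  have h := lp.inner_single_left (𝕜 := ℂ) y (1 : ℂ) (star (orbitOp f) (lp.single 2 x (1 : ℂ)))
  have h' := lp.inner_single_right (𝕜 := ℂ) x (1 : ℂ) (orbitOp f (lp.single 2 y (1 : ℂ)))
  rw [ContinuousLinearMap.star_eq_adjoint, ContinuousLinearMap.adjoint_inner_right, h'] at h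
  simp only [RCLike.inner_apply, map_one, mul_one, one_mul] at h
  simp only [ContinuousLinearMap.comp_apply, lp.singleContinuousLinearMap_apply]
  rw [orbitOp_single_star, ContinuousLinearMap.star_eq_adjoint, ← h]
  rfl

variable (G) in
/-- The representation of `C_c(G)` on `ℓ²(G⁽⁰⁾)`. -/
noncomputable def orbitRep : BoundedRep G where
  H := L2Units G
  π :=
    { toFun := orbitOp
      map_smul' := fun c f => ContinuousLinearMap.ext fun x => lp.ext <| funext fun y => by
        change ∑' α : RngFiber (y : G), c * f α * x (s (α : G)) = c * orbitFun f x y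
        rw [orbitFun, ← tsum_mul_left]
        exact tsum_congr fun α => _root_.mul_assoc _ _ _
      map_zero' := ContinuousLinearMap.ext fun x => lp.ext <| funext fun y => by
        change ∑' α : RngFiber (y : G), (0 : ℂ) * x (s (α : G)) = 0
        simp
      map_add' := fun f g => ContinuousLinearMap.ext fun x => lp.ext <| funext fun y => by
        change ∑' α : RngFiber (y : G), (f α + g α) * x (s (α : G))
          = orbitFun f x y + orbitFun g x y
        rw [orbitFun, orbitFun, ← (summable_orbitFun f x y).tsum_add (summable_orbitFun g x y)]
        exact tsum_congr fun α => add_mul _ _ _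
      map_mul' := fun f g => ContinuousLinearMap.ext fun x => lp.ext <| funext fun y =>
        congrFun (orbitFun_mul f g x) y
      map_star' := orbitOp_star }
  bounded := ⟨1, fun f => (norm_orbitOp_le f).trans_eq (one_mul _).symm⟩

/-! ### From simplicity to effectiveness, and from there to topological principality. -/

section LocallyCompact

variable [LocallyCompactSpace G]

lemma orbitFun_unit {k : ConvAlgebra G} (hk : ∀ γ ∉ unitSpace G, k γ = 0) (x : unitSpace G → ℂ)
    (y : unitSpace G) : orbitFun k x y = k y * x y := by
  rw [orbitFun, tsum_eq_single (⟨y, rng_unit y.2⟩ : RngFiber (y : G))]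
  · rw [show s (y : G) = y from Subtype.ext (src_unit y.2)]
  · intro α hα
    rw [hk, zero_mul]
    intro hu
    exact hα (Subtype.ext ((rng_unit hu).symm.trans α.2))

/-- If `C*(G)` is simple, `G` is effective: open subsets of the isotropy consist of units. -/
lemma subset_unitSpace_of_isSimple (hs : IsSimpleCStarAlgebra (FullCStar G)) {W : Set G}
    (hW : IsOpen W) (hiso : ∀ γ ∈ W, rng γ = src γ) : W ⊆ unitSpace G := by
  intro γ₀ hγ₀
  by_contra hnot
  obtain ⟨e, he₀, he⟩ := isLocalHomeomorph_src (G := G) γ₀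
  -- `O` is an open bisection of non-unit isotropy arrows: `src` is injective on it, and `rng`
  -- agrees with `src` there.
  set O : Set G := (W \ unitSpace G) ∩ e.source
  have hO : IsOpen O := (hW.sdiff isClosed_unitSpace).inter e.open_source
  obtain ⟨N, hN, hγN, hNO⟩ := exists_compact_subset hO ⟨⟨hγ₀, hnot⟩, he₀⟩
  obtain ⟨φ, hφ1, -, hφ0, -⟩ := exists_bump hN hO hNO
  have hV : IsOpen (src '' interior N) := isLocalHomeomorph_src.isOpenMap _ isOpen_interior
  obtain ⟨k, hk1, -, hk0, -⟩ := exists_bump_at hV ⟨γ₀, hγN, rfl⟩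
  have hkX : ∀ γ ∉ unitSpace G, k γ = 0 := fun γ hγ => hk0 γ <| by
    rintro ⟨α, -, rfl⟩; exact hγ (src_mem α)
  have hinj : ∀ α ∈ O, ∀ β ∈ O, src α = src β → α = β := fun α hα β hβ h =>
    e.injOn hα.2 hβ.2 (by rw [← he]; exact h)
  -- Over a unit `y` in `src '' interior N` there is exactly one arrow of `O`. It is an isotropy
  -- arrow at which `φ` is `1`, so `φ * k` acts as multiplication by `k`. Elsewhere `k` vanishes.
  have hfun : ∀ (x : unitSpace G → ℂ) (y : unitSpace G), orbitFun (φ * k) x y = k y * x y := by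
    intro x y
    rw [orbitFun]
    simp only [mul_unit_apply hkX]
    by_cases hy : (y : G) ∈ src '' interior N
    · obtain ⟨α, hα, hαy⟩ := hy
      have hαO : α ∈ O := hNO (interior_subset hα)
      rw [tsum_eq_single (⟨α, (hiso α hαO.1.1).trans hαy⟩ : RngFiber (y : G))]
      · rw [hφ1 α (interior_subset hα), one_mul]
        change k (src α) * x (s α) = _
        rw [show s α = y from Subtype.ext hαy, hαy]
      · intro β hβ
        rw [hφ0 β, zero_mul, zero_mul]
        intro hβO
        refine hβ (Subtype.ext (hinj _ hβO _ hαO ?_))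
        rw [← hiso _ hβO.1.1, β.2, hαy]
    · rw [hk0 y hy, zero_mul]
      refine (tsum_congr fun β => ?_).trans tsum_zero
      by_cases hβO : (β : G) ∈ O
      · rw [← hiso _ hβO.1.1, β.2, hk0 y hy, mul_zero, zero_mul]
      · rw [hφ0 β hβO, zero_mul, zero_mul]
  have hop : orbitOp (φ * k) = orbitOp k :=
    ContinuousLinearMap.ext fun x => lp.ext <| funext fun y =>
      (hfun x y).trans (orbitFun_unit hkX x y).symm
  have hne : ∃ f, (orbitRep G).π f ≠ 0 := by
    classical
    refine ⟨k, fun h => ?_⟩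
    have h1 := orbitOp_single k (s γ₀) (s γ₀)
    rw [show orbitOp k = 0 from h, tsum_eq_single (src γ₀), if_pos, hk1] at h1
    · exact zero_ne_one h1
    · exact ⟨rng_src _, src_src _⟩
    · intro α hα
      refine ite_eq_right_iff.2 fun h => hkX α fun hu => hα ?_
      rw [← src_unit hu]; exact h.2
  have hz : φ * k - k = 0 := (orbitRep G).eq_zero hs hne <| by
    rw [map_sub, sub_eq_zero]; exact hop
  -- The two functions act equally but differ at the unit `src γ₀`: `φ` vanishes on units, while `k`
  -- is `1` there.
  have h1 : (φ * k) (src γ₀) = k (src γ₀) := by rw [sub_eq_zero.1 hz]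
  rw [mul_unit_apply hkX, src_src, hk1, hφ0 _ fun h => h.1.2 (src_mem γ₀), zero_mul] at h1
  exact zero_ne_one h1

/-- A second-countable effective étale groupoid is topologically principal. -/
lemma isTopologicallyPrincipal_of_effective [SecondCountableTopology G]
    (heff : ∀ W : Set G, IsOpen W → (∀ γ ∈ W, rng γ = src γ) → W ⊆ unitSpace G) :
    IsTopologicallyPrincipal G := by
  -- A locally compact Hausdorff space is a Baire space; this instance serves the countable
  -- intersection below.
  have : LocallyCompactSpace (unitSpace G) := (isOpen_unitSpace G).locallyCompactSpace
  choose e he₀ he using fun γ : G => isLocalHomeomorph_src (G := G) γ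
  have hN : ∀ γ : G, ∃ N : Set G, IsCompact N ∧ (γ ∉ unitSpace G →
      γ ∈ interior N ∧ N ⊆ (e γ).source \ unitSpace G) := by
    intro γ
    by_cases hγ : γ ∈ unitSpace G
    · exact ⟨∅, isCompact_empty, fun h => absurd hγ h⟩
    · obtain ⟨N, hN, hγN, hNO⟩ := exists_compact_subset
        ((e γ).open_source.sdiff isClosed_unitSpace) (show γ ∈ _ from ⟨he₀ γ, hγ⟩)
      exact ⟨N, hN, fun _ => ⟨hγN, hNO⟩⟩
  choose N hNc hN using hN
  obtain ⟨t, ht, htc, hcov⟩ := TopologicalSpace.countable_cover_nhdsWithin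
    (s := (unitSpace G)ᶜ) (f := N) fun γ hγ =>
      mem_nhdsWithin_of_mem_nhds (mem_interior_iff_mem_nhds.1 (hN γ hγ).1)
  -- `D γ` consists of the units with an isotropy arrow in `N γ`. Countably many of the sets `N γ`
  -- cover the non-units, so it suffices that each such `D γ` is closed with empty interior.
  set D : G → Set (unitSpace G) := fun γ => s '' (N γ ∩ {α | rng α = src α})
  have hDc : ∀ γ, IsClosed (D γ) := fun γ =>
    (((hNc γ).inter_right (isClosed_eq continuous_rng continuous_src)).image
      EtaleGroupoid.continuous_s).isClosed
  have hD : ∀ γ ∈ t, Dense (D γ)ᶜ := by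
    intro γ hγ
    rw [← interior_eq_empty_iff_dense_compl, Set.eq_empty_iff_forall_notMem]
    intro y hy
    have hNγ := (hN γ (ht hγ)).2
    -- By injectivity of the source map on the chart, every arrow of the chart over `interior (D γ)`
    -- is the isotropy arrow witnessing membership in `D γ`. Effectiveness makes these arrows units,
    -- but those witnesses lie in `N γ`, which contains no units.
    have hsub := heff ((e γ).source ∩ s ⁻¹' interior (D γ))
      ((e γ).open_source.inter (isOpen_interior.preimage EtaleGroupoid.continuous_s)) (by
        rintro α ⟨hα, hαD⟩
        obtain ⟨β, ⟨hβN, hβ⟩, hβα⟩ := interior_subset hαD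
        have : β = α := (e γ).injOn (hNγ hβN).1 hα (by
          rw [← he]; exact congrArg Subtype.val hβα)
        exact this ▸ hβ)
    obtain ⟨β, ⟨hβN, -⟩, hβy⟩ := interior_subset hy
    exact (hNγ hβN).2 (hsub ⟨(hNγ hβN).1, by rwa [Set.mem_preimage, hβy]⟩)
  refine (dense_biInter_of_isOpen (fun γ _ => (hDc γ).isOpen_compl) htc hD).mono ?_
  intro v hv
  refine Set.Subset.antisymm ?_ ?_
  · rintro α ⟨hr, hs'⟩
    have hαiso : rng α = src α := congrArg Subtype.val (hr.trans hs'.symm)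
    by_cases hα : α ∈ unitSpace G
    · rw [Set.mem_singleton_iff, ← hr]; exact (rng_unit hα).symm
    · obtain ⟨γ, hγ, hαN⟩ := Set.mem_iUnion₂.1 (hcov hα)
      exact absurd ⟨α, ⟨hαN, hαiso⟩, hs'⟩ (Set.mem_iInter₂.1 hv γ hγ)
  · rintro _ rfl
    exact ⟨Subtype.ext (rng_unit v.2), Subtype.ext (src_unit v.2)⟩

end LocallyCompact

/-! ### The regular representations of the reduced C*-algebra -/

/-- The regular representation of `C*_r(G)` on `ℓ²(G_v)`. -/
noncomputable def reducedRep {v : G} (hv : v ∈ unitSpace G) :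
    ReducedCStar G →⋆ₙₐ[ℂ] (L2Fiber v →L[ℂ] L2Fiber v) :=
  CStarSeminorm.extend (reducedNorm G) (regularRep v) fun f => norm_indOp_le_reducedNorm f hv

lemma reducedRep_toCompl {v : G} (hv : v ∈ unitSpace G) (f : ConvAlgebra G) :
    reducedRep hv ((reducedNorm G).toCompl f) = indOp v f :=
  CStarSeminorm.extend_toCompl _ _ _ f

lemma continuous_reducedRep {v : G} (hv : v ∈ unitSpace G) : Continuous (reducedRep hv) :=
  CStarSeminorm.continuous_extend _ _ _

lemma norm_reducedRep_le {v : G} (hv : v ∈ unitSpace G) (x : ReducedCStar G) :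
    ‖reducedRep hv x‖ ≤ ‖x‖ :=
  CStarSeminorm.norm_extend_le _ _ _ x

open Classical in
/-- The basis vector of `ℓ²(G_v)` at `β`. -/
noncomputable def delta {v : G} (β : SrcFiber v) : L2Fiber v := lp.single 2 β (1 : ℂ)

lemma norm_delta {v : G} (β : SrcFiber v) : ‖delta β‖ = 1 := by
  classical
  rw [delta, lp.norm_single (by simp), norm_one]

lemma indOp_delta (v : G) (f : ConvAlgebra G) (β γ : SrcFiber v) :
    indOp v f (delta β) γ = ker f v γ β :=
  indOp_single v f β γ

/-- A unit, as an arrow with source itself. -/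
def unitPt {v : G} (hv : v ∈ unitSpace G) : SrcFiber v := ⟨v, src_unit hv⟩

lemma ker_unitPt (f : ConvAlgebra G) {v : G} (hv : v ∈ unitSpace G) (γ : SrcFiber v) :
    ker f v γ (unitPt hv) = f γ := by
  change f ((γ : G) * v⁻¹) = f γ
  have h : (γ : G) * v = γ := by
    have := self_mul_src (γ : G)
    rwa [γ.2] at this
  rw [inv_unit hv, h]

/-- Right translation by `β` identifies `G_v` with the source fibre of `rng β` and takes `β` to the
unit. It carries the column `γ ↦ f (γ β⁻¹)` to `f` on that fibre. -/
lemma norm_indOp_delta (f : ConvAlgebra G) {v : G} (β : SrcFiber v) :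
    ‖indOp v f (delta β)‖
      = ‖indOp (rng (β : G)) f (delta (unitPt (rng_mem (β : G))))‖ := by
  have h1 := lp_tsum_enorm (indOp v f (delta β))
  have h2 := lp_tsum_enorm (indOp (rng (β : G)) f (delta (unitPt (rng_mem (β : G)))))
  simp_rw [indOp_delta] at h1 h2
  simp_rw [ker_unitPt] at h2
  have h3 := (srcEquiv β).tsum_eq fun γ => ‖f γ‖ₑ ^ 2
  have h4 := (h1.symm.trans h3).trans h2
  rw [ENNReal.ofReal_eq_ofReal_iff (by positivity) (by positivity)] at h4
  exact (sq_eq_sq₀ (norm_nonneg _) (norm_nonneg _)).1 h4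

lemma norm_reducedRep_delta {v : G} (hv : v ∈ unitSpace G) (β : SrcFiber v)
    (x : ReducedCStar G) :
    ‖reducedRep hv x (delta β)‖
      = ‖reducedRep (rng_mem (β : G)) x (delta (unitPt (rng_mem (β : G))))‖ := by
  revert x
  refine CStarSeminorm.ind₁ _ (isClosed_eq ?_ ?_) fun f => ?_
  · exact ((continuous_reducedRep hv).clm_apply continuous_const).norm
  · exact ((continuous_reducedRep _).clm_apply continuous_const).norm
  · rw [reducedRep_toCompl, reducedRep_toCompl, norm_indOp_delta]

/-- The regular representations separate the points of `C*_r(G)`. -/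
lemma eq_zero_of_reducedRep {a : ReducedCStar G}
    (h : ∀ (v : G) (hv : v ∈ unitSpace G), reducedRep hv a = 0) : a = 0 := by
  -- For `x` in `C_c(G)` the norm is computed by the regular representations, which do not see `a`.
  -- By density the bound extends to every `x`, and `x = a` finishes.
  have key : ∀ x : ReducedCStar G, ‖x‖ ≤ ‖x - a‖ := by
    refine CStarSeminorm.ind₁ _ (isClosed_le continuous_norm
      (continuous_id.sub continuous_const).norm) fun f => ?_
    rw [CStarSeminorm.norm_toCompl]
    refine reducedNorm_le (norm_nonneg _) fun v hv => ?_
    have := norm_reducedRep_le hv ((reducedNorm G).toCompl f - a)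
    rwa [map_sub, h v hv, sub_zero, reducedRep_toCompl] at this
  have := key a
  rw [sub_self, norm_zero] at this
  exact norm_le_zero_iff.1 this

/-- A nonzero element of `C*_r(G)` does not kill all the vectors `δ_v`, `v` a unit. -/
lemma exists_reducedRep_delta_ne_zero {a : ReducedCStar G} (ha : a ≠ 0) :
    ∃ (v : G) (hv : v ∈ unitSpace G), reducedRep hv a (delta (unitPt hv)) ≠ 0 := by
  by_contra! h
  refine ha (eq_zero_of_reducedRep fun v hv => ?_)
  classical
  refine lp.ext_continuousLinearMap (by simp) fun β => ContinuousLinearMap.ext_ring ?_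
  have h1 := norm_reducedRep_delta hv β a
  rw [h, norm_zero, norm_eq_zero] at h1
  simp only [ContinuousLinearMap.comp_apply, lp.singleContinuousLinearMap_apply]
  rw [_root_.zero_apply, ← h1, delta]

/-- The value at the unit `v` of the conditional expectation of an element of `C*_r(G)`. -/
noncomputable def expect {v : G} (hv : v ∈ unitSpace G) (x : ReducedCStar G) : ℂ :=
  reducedRep hv x (delta (unitPt hv)) (unitPt hv)

lemma expect_toCompl {v : G} (hv : v ∈ unitSpace G) (f : ConvAlgebra G) :
    expect hv ((reducedNorm G).toCompl f) = f v := by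
  rw [expect, reducedRep_toCompl, indOp_delta, ker_unitPt]
  rfl

lemma expect_sub {v : G} (hv : v ∈ unitSpace G) (x y : ReducedCStar G) :
    expect hv (x - y) = expect hv x - expect hv y := by
  rw [expect, map_sub]
  rfl

lemma norm_expect_le {v : G} (hv : v ∈ unitSpace G) (x : ReducedCStar G) :
    ‖expect hv x‖ ≤ ‖x‖ := by
  refine (lp.norm_apply_le_norm (by simp) _ _).trans ?_
  refine (ContinuousLinearMap.le_opNorm _ _).trans ?_
  rw [norm_delta, mul_one]
  exact norm_reducedRep_le hv x

/-- The expectation is the vector state at the basis vector of `v`. With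
`exists_reducedRep_delta_ne_zero` this shows that it is faithful on `C*_r(G)`. -/
lemma expect_star_mul_self {v : G} (hv : v ∈ unitSpace G) (x : ReducedCStar G) :
    expect hv (star x * x) = (‖reducedRep hv x (delta (unitPt hv))‖ ^ 2 : ℝ) := by
  classical
  have h := lp.inner_single_left (𝕜 := ℂ) (unitPt hv) (1 : ℂ)
    (reducedRep hv (star x * x) (delta (unitPt hv)))
  have hd : (lp.single 2 (unitPt hv) (1 : ℂ) : L2Fiber v) = delta (unitPt hv) := by
    rw [delta]
  rw [hd, map_mul, map_star, mul_apply_eq_comp, ContinuousLinearMap.star_eq_adjoint,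
    ContinuousLinearMap.adjoint_inner_right, inner_self_eq_norm_sq_to_K] at h
  simp only [RCLike.inner_apply, map_one, mul_one] at h
  rw [expect, map_mul, map_star, mul_apply_eq_comp,
    ContinuousLinearMap.star_eq_adjoint, ← h]
  push_cast
  rfl

/-! ### Functions supported on the unit space -/

/-- A range or source fibre over a unit contains only that unit, so the `I`-norm is bounded by the
sup norm. -/
lemma iNorm_le_of_unit {h : ConvAlgebra G} (hh : ∀ γ ∉ unitSpace G, h γ = 0) {C : ℝ}
    (hC : 0 ≤ C) (hb : ∀ γ, ‖h γ‖ ≤ C) : iNorm h ≤ C := by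
  refine Real.iSup_le (fun v => max_le ?_ ?_) hC
  · rw [tsum_eq_single (unitPt v.2)]
    · exact hb _
    · intro γ hγ
      rw [hh, norm_zero]
      intro hu
      exact hγ (Subtype.ext ((src_unit hu).symm.trans γ.2))
  · rw [tsum_eq_single (⟨v, rng_unit v.2⟩ : RngFiber (v : G))]
    · exact hb _
    · intro γ hγ
      rw [hh, norm_zero]
      intro hu
      exact hγ (Subtype.ext ((rng_unit hu).symm.trans γ.2))

lemma reducedNorm_le_of_unit {h : ConvAlgebra G} (hh : ∀ γ ∉ unitSpace G, h γ = 0) {C : ℝ}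
    (hC : 0 ≤ C) (hb : ∀ γ, ‖h γ‖ ≤ C) : (reducedNorm G).toSeminorm h ≤ C :=
  reducedNorm_le hC fun v _ => (norm_indOp_le v h).trans (iNorm_le_of_unit hh hC hb)

/-- Off its support `f` vanishes locally, so the convention `0 / 0 = 0` causes no discontinuity
where `d` vanishes. -/
lemma exists_div (f : ConvAlgebra G) {d : G → ℂ} (hd : Continuous d)
    (h : tsupport f ⊆ {γ | d γ ≠ 0}) : ∃ q : ConvAlgebra G, ∀ γ, q γ = f γ / d γ := by
  refine ⟨mk' (fun γ => f γ / d γ) ?_ ?_, fun γ => rfl⟩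
  · rw [continuous_iff_continuousAt]
    intro γ
    by_cases hγ : γ ∈ tsupport f
    · exact f.continuous.continuousAt.div hd.continuousAt (h hγ)
    · refine ContinuousAt.congr (f := fun _ => 0) continuousAt_const ?_
      filter_upwards [(isClosed_tsupport f).isOpen_compl.mem_nhds hγ] with α hα
      rw [notMem hα, zero_div]
  · exact HasCompactSupport.intro f.isCompact fun γ hγ => by rw [notMem hγ, zero_div]

/-- Near a unit with trivial isotropy, the arrows in the support of `f` are units. -/
lemma exists_nhds_of_principal (f : ConvAlgebra G) {v : G} (hv : v ∈ unitSpace G)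
    (hp : ∀ γ : G, rng γ = v → src γ = v → γ = v) :
    ∃ V : Set G, IsOpen V ∧ v ∈ V ∧
      ∀ γ ∉ unitSpace G, rng γ ∈ V → src γ ∈ V → f γ = 0 := by
  have hK : IsCompact (tsupport f \ unitSpace G) := f.isCompact.diff (isOpen_unitSpace G)
  have hc : IsClosed ((fun γ : G => (rng γ, src γ)) '' (tsupport f \ unitSpace G)) :=
    (hK.image (continuous_rng.prodMk continuous_src)).isClosed
  -- A non-unit arrow from `v` to `v` is excluded by trivial isotropy. So the closed image of the
  -- compact non-unit part of the support misses `(v, v)`, and a product neighbourhood avoids it.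
  have hm : (v, v) ∈ ((fun γ : G => (rng γ, src γ)) '' (tsupport f \ unitSpace G))ᶜ := by
    rintro ⟨γ, ⟨-, hγ⟩, h⟩
    rw [Prod.mk.injEq] at h
    exact hγ (hp γ h.1 h.2 ▸ hv)
  obtain ⟨V, W, hV, hW, hvV, hvW, hVW⟩ := isOpen_prod_iff.1 hc.isOpen_compl v v hm
  refine ⟨V ∩ W, hV.inter hW, ⟨hvV, hvW⟩, fun γ hγ h1 h2 => ?_⟩
  by_contra h0
  exact hVW (show (rng γ, src γ) ∈ V ×ˢ W from ⟨h1.1, h2.2⟩)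
    ⟨γ, ⟨subset_tsupport _ h0, hγ⟩, rfl⟩

/-! ### Ideals of the reduced C*-algebra -/

variable [LocallyCompactSpace G]

/-- For topologically principal `G`, nonzero closed ideals of `C*_r(G)` contain nonzero functions
on the unit space. -/
lemma exists_unit_mem_ideal (hp : IsTopologicallyPrincipal G) {I : Submodule ℂ (ReducedCStar G)}
    (hc : IsClosed (I : Set (ReducedCStar G)))
    (hI : ∀ a : ReducedCStar G, ∀ x ∈ I, a * x ∈ I ∧ x * a ∈ I) (hne : I ≠ ⊥) :
    ∃ k : ConvAlgebra G, (∀ γ ∉ unitSpace G, k γ = 0) ∧ (reducedNorm G).toCompl k ∈ I ∧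
      ∃ v ∈ unitSpace G, k v ≠ 0 := by
  obtain ⟨a, haI, ha0⟩ := I.exists_mem_ne_zero_of_ne_bot hne
  obtain ⟨v, hv, hav⟩ := exists_reducedRep_delta_ne_zero ha0
  set b := star a * a
  have hbI : b ∈ I := (hI _ _ haI).1
  have hb : 0 < ‖expect hv b‖ := by
    rw [expect_star_mul_self, norm_pos_iff]
    exact_mod_cast pow_ne_zero 2 (norm_ne_zero_iff.2 hav)
  -- Of the `3 * ε`, approximating `b` by `f` costs less than `ε` and leaves `‖f v‖ > 2 * ε`.
  -- Dividing by `f` then costs a factor `1 / (2 * ε)`, so the final error is at most `1 / 2`.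
  obtain ⟨ε, hε, hbε⟩ : ∃ ε > 0, ‖expect hv b‖ = 3 * ε :=
    ⟨‖expect hv b‖ / 3, by positivity, by ring⟩
  obtain ⟨f, hf⟩ := (reducedNorm G).denseRange_toCompl.exists_dist_lt b hε
  rw [dist_eq_norm] at hf
  have hfv : 2 * ε < ‖f v‖ := by
    have h1 := norm_expect_le hv (b - (reducedNorm G).toCompl f)
    rw [expect_sub, expect_toCompl] at h1
    have h2 := norm_sub_norm_le (expect hv b) (f v)
    linarith
  have hopen : IsOpen {γ : G | 2 * ε < ‖f γ‖} := isOpen_lt continuous_const f.continuous.norm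
  obtain ⟨w, hw, hwf⟩ := hp.exists_mem_open (hopen.preimage continuous_subtype_val)
    ⟨⟨v, hv⟩, hfv⟩
  have hwp : ∀ γ : G, rng γ = w → src γ = w → γ = w := fun γ h1 h2 => by
    have : γ ∈ {γ : G | r γ = w ∧ s γ = w} := ⟨Subtype.ext h1, Subtype.ext h2⟩
    rw [show {γ : G | r γ = w ∧ s γ = w} = {(w : G)} from hw] at this
    exact this
  obtain ⟨V, hV, hwV, hVf⟩ := exists_nhds_of_principal f w.2 hwp
  set V' : Set G := (V ∩ {γ : G | 2 * ε < ‖f γ‖}) ∩ unitSpace G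
  have hV' : IsOpen V' := (hV.inter hopen).inter (isOpen_unitSpace G)
  obtain ⟨N, hN, hwN, hNV⟩ := exists_compact_subset hV' ⟨⟨hwV, hwf⟩, w.2⟩
  obtain ⟨h, h1, h2, h3, h4⟩ := exists_bump hN hV' hNV
  have hf0 : ∀ γ ∈ V', f γ ≠ 0 := fun γ hγ h0 => by
    have := hγ.1.2
    rw [Set.mem_ofPred_eq, h0, norm_zero] at this
    linarith
  -- With `q = h / f`, the product `q * f * h` vanishes off the unit space by the choice of `V` and
  -- equals `1` on `N`. It therefore acts as an identity on `e`.
  obtain ⟨q, hq⟩ := exists_div h f.continuous fun γ hγ => hf0 γ (h2 hγ)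
  have hq0 : ∀ γ ∉ V', q γ = 0 := fun γ hγ => by rw [hq, h3 γ hγ, zero_div]
  have hhX : ∀ γ ∉ unitSpace G, h γ = 0 := fun γ hγ => h3 γ fun h' => hγ h'.2
  have hqX : ∀ γ ∉ unitSpace G, q γ = 0 := fun γ hγ => hq0 γ fun h' => hγ h'.2
  have hqn : (reducedNorm G).toSeminorm q ≤ 1 / (2 * ε) := by
    refine reducedNorm_le_of_unit hqX (by positivity) fun γ => ?_
    by_cases hγ : γ ∈ V'
    · rw [hq, norm_div]
      exact div_le_div₀ zero_le_one (h4 γ) (by positivity) (le_of_lt hγ.1.2)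
    · rw [hq0 γ hγ, norm_zero]; positivity
  have hhn : (reducedNorm G).toSeminorm h ≤ 1 := reducedNorm_le_of_unit hhX zero_le_one h4
  set k := q * f * h with hk
  have hkapp : ∀ γ, k γ = q (rng γ) * f γ * h (src γ) := fun γ => by
    rw [hk, mul_unit_apply hhX, unit_mul_apply hqX]
  obtain ⟨e, he1, -, he0, -⟩ := exists_bump_at isOpen_interior hwN
  have heX : ∀ γ ∉ unitSpace G, e γ = 0 := fun γ hγ =>
    he0 γ fun h' => hγ (hNV (interior_subset h')).2
  refine ⟨e, heX, ?_, w, w.2, by rw [he1]; exact one_ne_zero⟩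
  refine Submodule.mem_of_norm_sub_lt_one hc hI
    (g := (reducedNorm G).toCompl q * b * (reducedNorm G).toCompl h)
    (k := (reducedNorm G).toCompl k) (hI _ _ (hI _ _ hbI).1).2 ?_ ?_
  · rw [hk, CStarSeminorm.toCompl_mul, CStarSeminorm.toCompl_mul, ← sub_mul, ← mul_sub]
    calc _ ≤ ‖(reducedNorm G).toCompl q‖ * ‖(reducedNorm G).toCompl f - b‖ *
          ‖(reducedNorm G).toCompl h‖ :=
          (norm_mul_le _ _).trans (mul_le_mul_of_nonneg_right (norm_mul_le _ _) (norm_nonneg _))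
      _ ≤ 1 / (2 * ε) * ε * 1 := by
          rw [norm_sub_rev, CStarSeminorm.norm_toCompl, CStarSeminorm.norm_toCompl]
          gcongr
      _ < 1 := by field_simp; norm_num
  · rw [← CStarSeminorm.toCompl_mul]
    congr 1
    refine ext fun γ => ?_
    rw [unit_mul_apply heX]
    by_cases hγ : γ ∈ unitSpace G
    · rw [rng_unit hγ, hkapp, rng_unit hγ, src_unit hγ]
      by_cases hγN : γ ∈ interior N
      · have hγN' := interior_subset hγN
        rw [hq, h1 γ hγN', mul_one, div_mul_cancel₀ _ (hf0 γ (hNV hγN')), mul_one]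
      · rw [he0 γ hγN, zero_mul]
    · by_cases hrs : rng γ ∈ V' ∧ src γ ∈ V'
      · rw [hkapp, hVf γ hγ hrs.1.1.1 hrs.2.1.1, heX γ hγ]; simp
      · rw [hkapp, heX γ hγ]
        by_cases hr : rng γ ∈ V'
        · rw [h3 (src γ) fun h' => hrs ⟨hr, h'⟩]; simp
        · rw [hq0 _ hr]; simp

/-- Conjugating a function on the unit space by a bump function on a bisection. -/
lemma exists_conj (k : ConvAlgebra G) (hk : ∀ γ ∉ unitSpace G, k γ = 0) (γ : G) :
    ∃ n : ConvAlgebra G, (∀ α ∉ unitSpace G, (n * k * star n) α = 0) ∧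
      (n * k * star n) (rng γ) = k (src γ) := by
  obtain ⟨e₁, h₁, he₁⟩ := isLocalHomeomorph_rng (G := G) γ
  obtain ⟨e₂, h₂, he₂⟩ := isLocalHomeomorph_src (G := G) γ
  obtain ⟨n, hn1, -, hn0, -⟩ := exists_bump_at (e₁.open_source.inter e₂.open_source) ⟨h₁, h₂⟩
  refine ⟨n, fun α hα => ?_, ?_⟩
  · rw [mul_apply]
    refine (tsum_congr fun β => ?_).trans tsum_zero
    rw [mul_unit_apply hk, star_apply]
    by_cases hβ : (β : G) ∈ e₁.source ∩ e₂.source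
    · rw [hn0 ((β : G)⁻¹ * α)⁻¹, star_zero, mul_zero]
      intro hδ
      -- Both arrows lie in the bisection and have the same source, so they agree. Then `α = β β⁻¹`
      -- is a unit.
      have hs : ((β : G)⁻¹ * α)⁻¹ = β := e₂.injOn hδ.2 hβ.2 <| by
        rw [← he₂, src_inv, rng_mul_right β.2]
      have h := inv_mul_cancel_left (a := (β : G)) (b := α) β.2
      rw [← inv_inv_self ((β : G)⁻¹ * α), hs, ArrowGroupoid.mul_inv] at h
      exact hα (h ▸ rng_mem _)
    · rw [hn0 _ hβ, zero_mul, zero_mul]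
  · rw [mul_apply, tsum_eq_single ⟨γ, (rng_rng γ).symm⟩]
    · simp only
      rw [mul_unit_apply hk, star_apply, ← src_inv γ, self_mul_src, inv_inv_self, hn1]
      simp
    · intro β hβ
      rw [mul_unit_apply hk, hn0 β, zero_mul, zero_mul]
      intro hβ'
      refine hβ (Subtype.ext (e₁.injOn hβ'.1 h₁ ?_))
      exact (congrFun he₁ β).symm.trans ((β.2.trans (rng_rng γ)).trans (congrFun he₁ γ))

/-- For minimal `G`, a closed ideal of `C*_r(G)` containing a nonzero function on the unit space is
everything. -/
lemma ideal_eq_top (hm : IsMinimal G) {I : Submodule ℂ (ReducedCStar G)}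
    (hc : IsClosed (I : Set (ReducedCStar G)))
    (hI : ∀ a : ReducedCStar G, ∀ x ∈ I, a * x ∈ I ∧ x * a ∈ I)
    (hne : ∃ k : ConvAlgebra G, (∀ γ ∉ unitSpace G, k γ = 0) ∧ (reducedNorm G).toCompl k ∈ I ∧
      ∃ v ∈ unitSpace G, k v ≠ 0) : I = ⊤ := by
  set U : Set (unitSpace G) := {v | ∃ k : ConvAlgebra G, (∀ γ ∉ unitSpace G, k γ = 0) ∧
    (reducedNorm G).toCompl k ∈ I ∧ k v ≠ 0}
  have hUo : IsOpen U := by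
    rw [isOpen_iff_mem_nhds]
    rintro v ⟨k, hk, hkI, hkv⟩
    filter_upwards [(k.continuous.comp continuous_subtype_val).continuousAt.eventually_ne hkv]
      with w hw using ⟨k, hk, hkI, hw⟩
  have hUinv : IsInvariant U := by
    rintro γ ⟨k, hk, hkI, hkγ⟩
    obtain ⟨n, hn, hnγ⟩ := exists_conj k hk γ
    refine ⟨_, hn, ?_, hnγ.symm ▸ hkγ⟩
    rw [CStarSeminorm.toCompl_mul, CStarSeminorm.toCompl_mul]
    exact (hI _ _ (hI _ _ hkI).1).2
  have hU : U = Set.univ := by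
    obtain ⟨k, hk, hkI, v, hv, hkv⟩ := hne
    refine (hm U hUo hUinv).resolve_left (Set.Nonempty.ne_empty ⟨⟨v, hv⟩, k, hk, hkI, hkv⟩)
  -- Compactness glues local witnesses by addition. The values are required to be nonnegative so
  -- that sums cannot cancel; locally `star k * k`, with values `‖k‖ ^ 2` on units, supplies them.
  have hloc : ∀ K : Set G, IsCompact K → K ⊆ unitSpace G → ∃ m : ConvAlgebra G,
      (∀ γ ∉ unitSpace G, m γ = 0) ∧ (reducedNorm G).toCompl m ∈ I ∧
      (∀ γ, ∃ t : NNReal, m γ = t) ∧ ∀ γ ∈ K, m γ ≠ 0 := by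
    intro K hK hKX
    refine hK.induction_on (p := fun S => ∃ m : ConvAlgebra G,
      (∀ γ ∉ unitSpace G, m γ = 0) ∧ (reducedNorm G).toCompl m ∈ I ∧
      (∀ γ, ∃ t : NNReal, m γ = t) ∧ ∀ γ ∈ S, m γ ≠ 0) ?_ ?_ ?_ ?_
    · exact ⟨0, fun _ _ => rfl, by rw [CStarSeminorm.toCompl_zero]; exact I.zero_mem,
        fun γ => ⟨0, by simp⟩, fun γ h => absurd h (Set.notMem_empty γ)⟩
    · rintro S T hST ⟨m, h1, h2, h3, h4⟩
      exact ⟨m, h1, h2, h3, fun γ hγ => h4 γ (hST hγ)⟩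
    · rintro S T ⟨m, h1, h2, h3, h4⟩ ⟨m', h1', h2', h3', h4'⟩
      refine ⟨m + m', fun γ hγ => by rw [add_apply, h1 γ hγ, h1' γ hγ, add_zero],
        by rw [CStarSeminorm.toCompl_add]; exact I.add_mem h2 h2', fun γ => ?_, fun γ hγ => ?_⟩
      · obtain ⟨t, ht⟩ := h3 γ
        obtain ⟨t', ht'⟩ := h3' γ
        exact ⟨t + t', by rw [add_apply, ht, ht']; push_cast; rfl⟩
      · obtain ⟨t, ht⟩ := h3 γ
        obtain ⟨t', ht'⟩ := h3' γ
        rw [add_apply, ht, ht']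
        intro h0
        have h0' : t + t' = 0 := by exact_mod_cast h0
        rw [add_eq_zero] at h0'
        rcases hγ with hγ | hγ
        · exact h4 γ hγ (by rw [ht, h0'.1]; simp)
        · exact h4' γ hγ (by rw [ht', h0'.2]; simp)
    · intro v hv
      obtain ⟨k, hk, hkI, hkv⟩ : (⟨v, hKX hv⟩ : unitSpace G) ∈ U := hU ▸ Set.mem_univ _
      have hkk : ∀ γ, (star k * k) γ = star (k γ⁻¹) * k (src γ) := fun γ => by
        rw [mul_unit_apply hk, star_apply]
      have hX : ∀ γ ∈ unitSpace G, (star k * k) γ = (‖k γ‖₊ ^ 2 : NNReal) := fun γ hγ => by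
        rw [hkk, inv_unit hγ, src_unit hγ, ← starRingEnd_apply, Complex.conj_mul']
        push_cast; rfl
      have hnX : ∀ γ ∉ unitSpace G, (star k * k) γ = 0 := fun γ hγ => by
        rw [hkk, hk γ⁻¹, star_zero, zero_mul]
        intro h
        exact hγ (by rw [← inv_inv_self γ, inv_unit h]; exact h)
      refine ⟨{γ | k γ ≠ 0} ∩ unitSpace G, mem_nhdsWithin_of_mem_nhds (Filter.inter_mem
        (k.continuous.continuousAt.eventually_ne hkv) ((isOpen_unitSpace G).mem_nhds (hKX hv))),
        star k * k, hnX, ?_, fun γ => ?_, fun γ hγ => ?_⟩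
      · rw [CStarSeminorm.toCompl_mul]; exact (hI _ _ hkI).1
      · by_cases hγ : γ ∈ unitSpace G
        · exact ⟨_, hX γ hγ⟩
        · exact ⟨0, by rw [hnX γ hγ]; simp⟩
      · rw [hX γ hγ.2]
        have := hγ.1
        simpa using this
  have hall : ∀ f : ConvAlgebra G, (reducedNorm G).toCompl f ∈ I := by
    intro f
    obtain ⟨m, hm1, hm2, -, hm4⟩ := hloc (rng '' tsupport f) (f.isCompact.image continuous_rng)
      (by rintro _ ⟨γ, -, rfl⟩; exact rng_mem γ)
    -- Left multiplication by `m` multiplies by `m (rng γ)`, so dividing `f` by this factor gives `f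
    -- = m * q`.
    obtain ⟨q, hq⟩ := exists_div f (m.continuous.comp continuous_rng)
      fun γ hγ => hm4 _ ⟨γ, hγ, rfl⟩
    have : f = m * q := ext fun γ => by
      rw [unit_mul_apply hm1, hq, Function.comp_apply]
      by_cases hγ : γ ∈ tsupport f
      · rw [mul_div_cancel₀ _ (hm4 _ ⟨γ, hγ, rfl⟩)]
      · rw [notMem hγ, zero_div, mul_zero]
    rw [this, CStarSeminorm.toCompl_mul]
    exact (hI _ _ hm2).2
  exact Submodule.eq_top_iff'.2 fun x => CStarSeminorm.ind₁ (P := fun x => x ∈ I) _ hc hall x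

lemma isSimple_reducedCStar [Nonempty G] (hp : IsTopologicallyPrincipal G) (hm : IsMinimal G) :
    IsSimpleCStarAlgebra (ReducedCStar G) := by
  refine ⟨?_, fun I hc hI => ?_⟩
  · obtain ⟨γ⟩ := ‹Nonempty G›
    obtain ⟨f, hf, -⟩ := exists_bump_at (γ := γ) isOpen_univ trivial
    refine ⟨(reducedNorm G).toCompl f, 0, fun h => ?_⟩
    have h1 := norm_apply_le_reducedNorm f γ
    rw [← CStarSeminorm.norm_toCompl, h, norm_zero, hf, norm_one] at h1
    exact absurd h1 (by norm_num)
  · by_cases h : I = ⊥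
    · exact Or.inl h
    · exact Or.inr (ideal_eq_top hm hc hI (exists_unit_mem_ideal hp hc hI h))

end ConvAlgebra

/-- Simplicity of the full C*-algebra of a second-countable, locally compact, Hausdorff, étale
groupoid. -/
theorem theorem5p1 {G : Type*} [TopologicalSpace G] [EtaleGroupoid G] [T2Space G]
    [LocallyCompactSpace G] [SecondCountableTopology G] [Nonempty G] :
    IsSimpleCStarAlgebra (FullCStar G) ↔
      FullEqReduced G ∧ ArrowGroupoid.IsTopologicallyPrincipal G ∧ ArrowGroupoid.IsMinimal G := by
  constructor
  · intro hs
    exact ⟨ConvAlgebra.fullEqReduced_iff.2 (ConvAlgebra.fullNorm_eq_reducedNorm hs),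
      ConvAlgebra.isTopologicallyPrincipal_of_effective fun W hW h =>
        ConvAlgebra.subset_unitSpace_of_isSimple hs hW h,
      ConvAlgebra.isMinimal_of_isSimple hs⟩
  · rintro ⟨h1, h2, h3⟩
    have := ConvAlgebra.isSimple_reducedCStar h2 h3
    -- Exposes the seminorm in the type, so that the equality of the two norms can be rewritten.
    unfold ReducedCStar at this
    rwa [← ConvAlgebra.fullEqReduced_iff.1 h1] at this
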